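/- \textbf{Setting.} Let $\mathcal T\in\mathbb N$ and let one unit's observed panel data be $O=(Y_1,\dots,Y_{\mathcal T},D_1,\dots,D_{\mathcal T},Z_1,\dots,Z_{\mathcal T},X)$ with real outcomes $Y_s$, binary treatments $D_s$, a binary instrument path $Z_s$ and covariates $X$ in a measurable space. Put $E:=\min\{s: Z_s=1\}$ ($=\infty$ if there is no such $s$) and $E_e:=\mathbf 1\{E=e\}$. Fix $2\le e\le t\le\mathcal T$, write $\Delta V_t:=V_t-V_{e-1}$, and let $C$ be either the never-exposed indicator $C^{nev}=\mathbf 1\{E=\infty\}$ or the not-yet-exposed indicator $C^{nye}_{e,t}=\mathbf 1\{E_e=0,\,Z_t=0\}$. For a distribution $P$ of $O$ let \[ \rho=P(E_e=1),\quad p(X)=P(E_e=1\mid X,\,E_e+C=1),\quad m^{c}(X)=E[\Delta Y_t\mid X,C=1],\quad g^{c}(X)=E[\Delta D_t\mid X,C=1], \] \[ \tau^{num}=E\big[E[\Delta Y_t\mid X,E_e=1]-m^{c}(X)\,\big|\,E_e=1\big],\quad \tau^{den}=E\big[E[\Delta D_t\mid X,E_e=1]-g^{c}(X)\,\big|\,E_e=1\big],\quad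 \tau=\tau^{num}/\tau^{den}, \] \[ w^{trt}=\frac{E_e}{\rho},\qquad w^{c}=\frac{C\,p(X)}{1-p(X)}\Big/E\Big[\frac{C\,p(X)}{1-p(X)}\Big]. \] For $c>0$ let $\mathcal P_c$ be the set of all probability distributions of $O$ with $Z_1=0$ and $Z_{s-1}=1\Rightarrow Z_s=1$ a.s., $E[(\Delta Y_t)^2]<\infty$, $P(E_e=1)>c$, and $p(X)<1-c$ almost surely given $E_e+C=1$. The nonparametric model is $\bigcup_{c>0}\mathcal P_c$. A regular submodel through $P$ with score $s\in L^2(P)$ is a path $(P_\varepsilon)$ with $P_0=P$ which, for all $\varepsilon$ near $0$, lies in one common $\mathcal P_{c'}$, $c'>0$, and satisfies $P_\varepsilon\ll P$, and for which $\varepsilon^{-1}(dP_\varepsilon/dP-1)\to s$ in $L^2(P)$ as $\varepsilon\to0$. The tangent space is the closed linear span of all scores in $L^2(P)$. The efficient influence function of $\tau$ at $P$ is the mean-zero $\varphi\in L^2(P)$ in the tangent space with $\frac{d}{d\varepsilon}\tau(P_\varepsilon)\big|_{\varepsilon=0}=E[\varphi s]$ for every regular submodel, and the nonparametric efficiency bound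 is the supremum of $\big(\frac{d}{d\varepsilon}\tau(P_\varepsilon)|_{\varepsilon=0}\big)^2/E[s^2]$ over all regular submodels with $E[s^2]>0$. \textbf{Proposition.} Let $P\in\mathcal P_c$ for some $c>0$, and suppose $\tau^{den}\neq0$. Then the efficient influence function of $\tau$ at $P$ is \[ \varphi(O)=\frac1{\tau^{den}}\Big[\{w^{trt}-w^{c}\}\{\Delta Y_t-m^{c}(X)\}-\tau\,\{w^{trt}-w^{c}\}\{\Delta D_t-g^{c}(X)\}\Big], \] and the nonparametric efficiency bound equals $E[\varphi(O)^2]$. -/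

import Mathlib

open MeasureTheory ProbabilityTheory Filter Topology

noncomputable section

/-! ### Differentiable submodels, efficient influence functions, efficiency bounds -/

namespace Semiparametric

variable {O : Type*} [MeasurableSpace O]

/-- `Q` is a one-dimensional submodel through `P` whose likelihood ratio `dQ_ε / dP` is
differentiable at `ε = 0` in `L²(P)`, with derivative (score) `s`. -/
structure IsDifferentiablePath (P : Measure O) (Q : ℝ → Measure O) (s : O → ℝ) : Prop where
  zero : Q 0 = P
  isProbabilityMeasure : ∀ᶠ ε in 𝓝 (0 : ℝ), IsProbabilityMeasure (Q ε)
  absolutelyContinuous : ∀ᶠ ε in 𝓝 (0 : ℝ), Q ε ≪ P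
  memLp_score : MemLp s 2 P
  tendsto_score :
    Tendsto (fun ε : ℝ =>
        eLpNorm (fun o => ε⁻¹ * (((Q ε).rnDeriv P o).toReal - 1) - s o) 2 P)
      (𝓝[≠] 0) (𝓝 0)

/-- The tangent space at `P` of a class `S` of submodels, given as pairs (path, score):
the closed linear span in `L²(P)` of the scores. -/
def tangentSpace (S : Set ((ℝ → Measure O) × (O → ℝ))) (P : Measure O) :
    Submodule ℝ (Lp ℝ 2 P) :=
  (Submodule.span ℝ {f : Lp ℝ 2 P | ∃ q ∈ S, (f : O → ℝ) =ᵐ[P] q.2}).topologicalClosure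

/-- `φ` is the efficient influence function (canonical gradient) at `P` of the parameter `ψ`
with respect to the class `S` of submodels through `P`: it is mean zero and square integrable,
`ψ` is differentiable along every submodel with derivative `E[φ · score]`, and `φ` lies in the
tangent space. -/
structure IsEfficientInfluenceFunction (S : Set ((ℝ → Measure O) × (O → ℝ)))
    (P : Measure O) (ψ : Measure O → ℝ) (φ : O → ℝ) : Prop where
  memLp : MemLp φ 2 P
  integral_eq_zero : ∫ o, φ o ∂P = 0
  hasDerivAt : ∀ q ∈ S, HasDerivAt (fun ε : ℝ => ψ (q.1 ε)) (∫ o, φ o * q.2 o ∂P) 0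
  mem_tangentSpace : memLp.toLp φ ∈ tangentSpace S P

/-- `V` is the efficiency bound at `P` for `ψ`: the supremum, over the submodels in `S` with
nonzero Fisher information `E[score²]` at `0`, of the Cramér–Rao bounds. -/
def IsEfficiencyBound (S : Set ((ℝ → Measure O) × (O → ℝ)))
    (P : Measure O) (ψ : Measure O → ℝ) (V : ℝ) : Prop :=
  IsLUB {b : ℝ | ∃ q ∈ S, ∃ d : ℝ, 0 < ∫ o, q.2 o ^ 2 ∂P ∧
      HasDerivAt (fun ε : ℝ => ψ (q.1 ε)) d 0 ∧ b = d ^ 2 / ∫ o, q.2 o ^ 2 ∂P} V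

end Semiparametric

/-! ### The panel data structure -/

namespace Panel

/-- The periods `1, …, 𝒯`. -/
abbrev Period (𝒯 : ℕ) : Type := Set.Icc (1 : ℕ) 𝒯

/-- Observed panel data of one unit: outcome path, binary treatment path, binary instrument
path, covariates. -/
abbrev Obs (𝒯 : ℕ) (𝒳 : Type*) : Type _ :=
  (Period 𝒯 → ℝ) × (Period 𝒯 → Bool) × (Period 𝒯 → Bool) × 𝒳

/-- A cohort `e ∈ {2, …, 𝒯}` and a period `t ∈ {e, …, 𝒯}`. -/
structure CohortTime (𝒯 : ℕ) where
  e : ℕ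
  t : ℕ
  two_le : 2 ≤ e
  le_t : e ≤ t
  t_le : t ≤ 𝒯

/-- The period `t`. -/
def CohortTime.post {𝒯 : ℕ} (k : CohortTime 𝒯) : Period 𝒯 :=
  ⟨k.t, by have := k.two_le; have := k.le_t; omega, k.t_le⟩

/-- The last pre-exposure period `e - 1`. -/
def CohortTime.pre {𝒯 : ℕ} (k : CohortTime 𝒯) : Period 𝒯 :=
  ⟨k.e - 1, by have := k.two_le; omega, by have := k.le_t; have := k.t_le; omega⟩

/-- The two control groups: never exposed, and not yet exposed. -/
inductive ControlGroup
  | never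
  | notYet

variable {𝒯 : ℕ} {𝒳 : Type*}

/-- The outcome `Y_t`. -/
def outcome (t : Period 𝒯) (o : Obs 𝒯 𝒳) : ℝ := o.1 t

/-- The treatment status `D_t`, as a real number in `{0, 1}`. -/
def treatment (t : Period 𝒯) (o : Obs 𝒯 𝒳) : ℝ := if o.2.1 t = true then 1 else 0

/-- The instrument status: `Z_t = 1` iff `instrument t o = true`. -/
def instrument (t : Period 𝒯) (o : Obs 𝒯 𝒳) : Bool := o.2.2.1 t

/-- The covariates `X`. -/
def covariates (o : Obs 𝒯 𝒳) : 𝒳 := o.2.2.2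

/-- The exposure cohort `E = min {t | Z_t = 1}`, which is `∞` if there is no such `t`. -/
def cohort (o : Obs 𝒯 𝒳) : ℕ∞ :=
  ⨅ (t : Period 𝒯) (_ : instrument t o = true), ((t : ℕ) : ℕ∞)

/-- Staggered adoption: `Z_1 = 0`, and `Z_{t-1} = 1` implies `Z_t = 1`. -/
def IsStaggered (o : Obs 𝒯 𝒳) : Prop :=
  (∀ t : Period 𝒯, (t : ℕ) = 1 → instrument t o = false) ∧
  ∀ s t : Period 𝒯, (t : ℕ) = s + 1 → instrument s o = true → instrument t o = true

/-- The event `E_e = 1`, that is, `E = e`. -/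
def exposed (k : CohortTime 𝒯) : Set (Obs 𝒯 𝒳) := {o | cohort o = (k.e : ℕ∞)}

/-- The event `C = 1`: never exposed, `E = ∞`; or not yet exposed, `E ≠ e` and `Z_t = 0`. -/
def control (k : CohortTime 𝒯) : ControlGroup → Set (Obs 𝒯 𝒳)
  | .never => {o | cohort o = ⊤}
  | .notYet => {o | cohort o ≠ (k.e : ℕ∞) ∧ instrument k.post o = false}

/-- `Y_t - Y_{e-1}`. -/
def deltaY (k : CohortTime 𝒯) (o : Obs 𝒯 𝒳) : ℝ := outcome k.post o - outcome k.pre o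

/-- `D_t - D_{e-1}`. -/
def deltaD (k : CohortTime 𝒯) (o : Obs 𝒯 𝒳) : ℝ := treatment k.post o - treatment k.pre o

variable [MeasurableSpace 𝒳]

/-- `E_P[V | X, A]`: the conditional expectation of `V` given `X` under `P(· | A)`. -/
def condMean (P : Measure (Obs 𝒯 𝒳)) (A : Set (Obs 𝒯 𝒳)) (V : Obs 𝒯 𝒳 → ℝ) : Obs 𝒯 𝒳 → ℝ :=
  condExp (MeasurableSpace.comap (covariates : Obs 𝒯 𝒳 → 𝒳) inferInstance) (cond P A) V

/-- The generalized propensity score `p(X) = P(E_e = 1 | X, E_e + C = 1)`. -/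
def propensity (k : CohortTime 𝒯) (G : ControlGroup) (P : Measure (Obs 𝒯 𝒳)) : Obs 𝒯 𝒳 → ℝ :=
  condMean P (exposed k ∪ control k G) ((exposed k).indicator fun _ => 1)

/-- `E_P[ E_P[V | X, E_e = 1] - E_P[V | X, C = 1] | E_e = 1 ]`. -/
def attFunctional (k : CohortTime 𝒯) (G : ControlGroup) (V : Obs 𝒯 𝒳 → ℝ)
    (P : Measure (Obs 𝒯 𝒳)) : ℝ :=
  ∫ o, (condMean P (exposed k) V o - condMean P (control k G) V o) ∂(cond P (exposed k))

/-- The numerator of the estimand. -/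
def tauNum (k : CohortTime 𝒯) (G : ControlGroup) (P : Measure (Obs 𝒯 𝒳)) : ℝ :=
  attFunctional k G (deltaY k) P

/-- The denominator of the estimand. -/
def tauDen (k : CohortTime 𝒯) (G : ControlGroup) (P : Measure (Obs 𝒯 𝒳)) : ℝ :=
  attFunctional k G (deltaD k) P

/-- The estimand, as a functional of the observed-data distribution. -/
def tau (k : CohortTime 𝒯) (G : ControlGroup) (P : Measure (Obs 𝒯 𝒳)) : ℝ :=
  tauNum k G P / tauDen k G P

/-- `E_e / E[E_e]`. -/
def weightTrt (k : CohortTime 𝒯) (P : Measure (Obs 𝒯 𝒳)) (o : Obs 𝒯 𝒳) : ℝ :=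
  (exposed k).indicator (fun _ => 1) o / P.real (exposed k)

/-- `C p(X) / (1 - p(X))`. -/
def oddsCtrl (k : CohortTime 𝒯) (G : ControlGroup) (P : Measure (Obs 𝒯 𝒳)) : Obs 𝒯 𝒳 → ℝ :=
  (control k G).indicator fun o => propensity k G P o / (1 - propensity k G P o)

/-- The Hájek-normalized control weight. -/
def weightCtrl (k : CohortTime 𝒯) (G : ControlGroup) (P : Measure (Obs 𝒯 𝒳))
    (o : Obs 𝒯 𝒳) : ℝ :=
  oddsCtrl k G P o / ∫ o', oddsCtrl k G P o' ∂P

/-- The function `φ(O; τ, η)`. -/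
def eif (k : CohortTime 𝒯) (G : ControlGroup) (P : Measure (Obs 𝒯 𝒳)) (o : Obs 𝒯 𝒳) : ℝ :=
  1 / tauDen k G P *
    ((weightTrt k P o - weightCtrl k G P o) *
        (deltaY k o - condMean P (control k G) (deltaY k) o)
      - tau k G P * ((weightTrt k P o - weightCtrl k G P o) *
        (deltaD k o - condMean P (control k G) (deltaD k) o)))

/-- Observed-data distributions with overlap constant `c`. Apart from staggered adoption,
a finite second moment and overlap, the distribution is unrestricted. -/
structure InModel (k : CohortTime 𝒯) (G : ControlGroup) (c : ℝ)
    (P : Measure (Obs 𝒯 𝒳)) : Prop where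
  isProbabilityMeasure : IsProbabilityMeasure P
  staggered : ∀ᵐ o ∂P, IsStaggered o
  memLp_deltaY : MemLp (deltaY k) 2 P
  exposed_pos : c < P.real (exposed k)
  overlap : ∀ᵐ o ∂(cond P (exposed k ∪ control k G)), propensity k G P o < 1 - c

/-- All differentiable submodels of the nonparametric model through `P`, with their scores;
overlap holds uniformly along the submodel near `P`. -/
def submodels (k : CohortTime 𝒯) (G : ControlGroup) (P : Measure (Obs 𝒯 𝒳)) :
    Set ((ℝ → Measure (Obs 𝒯 𝒳)) × (Obs 𝒯 𝒳 → ℝ)) :=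
  {q | Semiparametric.IsDifferentiablePath P q.1 q.2 ∧
    ∃ c : ℝ, 0 < c ∧ ∀ᶠ ε in 𝓝 (0 : ℝ), InModel k G c (q.1 ε)}

end Panel

end

/-!
The estimand is the ratio of two functionals of the form
`E[E[V | X, E_e = 1] - E[V | X, C = 1] | E_e = 1]`, with `V = ΔY_t` and `V = ΔD_t`. By overlap, the
odds `w_Q = p_Q / (1 - p_Q)` are bounded and reweight the controls to the covariate distribution of
the exposed (`IsBalancingWeight`). Hence, for *any* function `g` of the covariates, `Q(E_e = 1)`
times the functional at `Q` equals `E_Q[(E_e - C w_Q)(V - g)]`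
(`IsBalancingWeight.integral_condExp_sub_condExp`). Taking for `g` the conditional mean
`E_P[V | X, C = 1]` under the *fixed* distribution `P` leaves two places where `Q` enters: the
measure and the weight.

Along a submodel `P_ε` with score `s`, the measure contributes `E[(E_e - C w_P)(V - g) s]` to the
derivative. The weight contributes nothing. Indeed `E_P[C w (V - g)] = 0` for every bounded function
`w` of the covariates, so the weight only enters through
`ε⁻¹ (E_{P_ε} - E_P)[C (w_ε - w_P)(V - g)]`, and this tends to `0` since the difference quotients of
the likelihood ratio converge in `L²(P)`, the weights are uniformly bounded, and `w_ε → w_P` in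
`L¹(P)` on the controls (`IsDifferentiablePath.hasDerivAt_integral_mul`). The last convergence
follows by testing `w_ε - w_P` against its sign and using the balancing property under both
distributions (`IsBalancingWeight.setIntegral_abs_sub_le`). In the ratio the factor `P_ε(E_e = 1)`
cancels, and the quotient rule gives the derivative `E[φ s]` (`Panel.hasDerivAt_tau`).

Conversely, for bounded mean-zero `s` the path `(1 + ε s) P` stays in the model, with a smaller
overlap constant (`overlap_of_le_smul`, `Panel.tilt_mem_submodels`). Bounded mean-zero functions
are dense among the mean-zero functions in `L²(P)`, so `φ` lies in the tangent space, and the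
Cramér–Rao bounds `E[φ s]² / E[s²]`, at most `E[φ²]` by the Cauchy–Schwarz inequality, come
arbitrarily close to `E[φ²]` (`isEfficient_of_bounded_scores`).
-/

/-! ### Differentiating expectations along a submodel -/

namespace Semiparametric

variable {O : Type*} [MeasurableSpace O]

/-- Bounded multipliers that tend to zero in `L¹` also tend to zero against any fixed integrable
function. -/
lemma tendsto_integral_mul_of_bounded {ι : Type*} {l : Filter ι} {μ : Measure O}
    [IsFiniteMeasure μ] {u : ι → O → ℝ} {f : O → ℝ} {K : ℝ} (hf : Integrable f μ)
    (hu : ∀ᶠ i in l, AEStronglyMeasurable (u i) μ) (hK : ∀ᶠ i in l, ∀ o, |u i o| ≤ K)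
    (hlim : Tendsto (fun i => ∫ o, |u i o| ∂μ) l (𝓝 0)) :
    Tendsto (fun i => ∫ o, u i o * f o ∂μ) l (𝓝 0) := by
  -- Truncate `f` at a level `n`: the bounded part is controlled by `hlim`, the tail by `K`.
  have htrunc : Tendsto (fun n : ℕ => ∫ o, (|f o| - min |f o| n) ∂μ) atTop (𝓝 0) := by
    have := tendsto_integral_of_dominated_convergence (μ := μ)
      (F := fun (n : ℕ) o => |f o| - min |f o| n) (f := fun _ => 0) (fun o => |f o|)
      (fun n => by
        have := hf.1
        exact (this.norm.sub (this.norm.inf aestronglyMeasurable_const)))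
      hf.norm (fun n => Eventually.of_forall fun o => by
        have h0 : 0 ≤ min |f o| (n : ℝ) := le_min (abs_nonneg _) n.cast_nonneg
        rw [Real.norm_eq_abs, abs_le]
        constructor <;> linarith [min_le_left |f o| (n : ℝ), abs_nonneg (f o)])
      (Eventually.of_forall fun o => by
        obtain ⟨N, hN⟩ := exists_nat_ge |f o|
        refine tendsto_const_nhds.congr' ?_
        filter_upwards [eventually_ge_atTop N] with n hn
        rw [min_eq_left (hN.trans (by exact_mod_cast hn)), sub_self])
    simpa using this
  rw [Metric.tendsto_nhds]
  intro δ hδ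
  have hK' : 0 < |K| + 1 := by positivity
  obtain ⟨n, hn⟩ := ((htrunc.eventually (gt_mem_nhds
    (show 0 < δ / 2 / (|K| + 1) by positivity)))).exists
  have hev := hlim.eventually (gt_mem_nhds (show 0 < δ / 2 / ((n : ℝ) + 1) by positivity))
  filter_upwards [hu, hK, hev] with i hui hKi hi
  have hiu : Integrable (fun o => |u i o|) μ :=
    (Integrable.of_bound hui K (Eventually.of_forall hKi)).norm
  have hit : Integrable (fun o => |f o| - min |f o| n) μ :=
    hf.norm.sub (hf.norm.inf (integrable_const _))
  rw [dist_zero_right]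
  calc ‖∫ o, u i o * f o ∂μ‖ ≤ ∫ o, (n * |u i o| + |K| * (|f o| - min |f o| n)) ∂μ := by
        refine norm_integral_le_of_norm_le ((hiu.const_mul _).add (hit.const_mul _))
          (Eventually.of_forall fun o => ?_)
        rw [norm_mul, Real.norm_eq_abs, Real.norm_eq_abs]
        have h1 : |u i o| ≤ |K| := (hKi o).trans (le_abs_self K)
        have h2 : 0 ≤ |f o| - min |f o| n := sub_nonneg.2 (min_le_left _ _)
        have h3 := min_le_right |f o| (n : ℝ)
        have h4 := abs_nonneg (u i o)
        nlinarith [mul_le_mul_of_nonneg_right h1 h2, mul_le_mul_of_nonneg_left h3 h4]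
    _ = n * ∫ o, |u i o| ∂μ + |K| * ∫ o, (|f o| - min |f o| n) ∂μ := by
        rw [integral_add (hiu.const_mul _) (hit.const_mul _), integral_const_mul,
          integral_const_mul]
    _ < δ := by
        have hn0 : (0 : ℝ) ≤ n := n.cast_nonneg
        have e1 := mul_le_mul_of_nonneg_left hi.le hn0
        have e2 := mul_le_mul_of_nonneg_left hn.le (abs_nonneg K)
        have e3 : (n : ℝ) * (δ / 2 / ((n : ℝ) + 1)) < δ / 2 := by
          rw [mul_div_assoc', div_lt_iff₀ (by positivity)]; nlinarith
        have e4 : |K| * (δ / 2 / (|K| + 1)) < δ / 2 := by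
          rw [mul_div_assoc', div_lt_iff₀ (by positivity)]; nlinarith
        linarith

/-- The Cauchy–Schwarz inequality with an additional bounded factor. -/
lemma enorm_integral_mul_le {μ : Measure O} {u f r : O → ℝ} {K : ℝ} (hu : ∀ o, |u o| ≤ K)
    (hf : AEStronglyMeasurable f μ) (hr : AEStronglyMeasurable r μ) :
    ‖∫ o, u o * f o * r o ∂μ‖ₑ ≤ ENNReal.ofReal K * (eLpNorm f 2 μ * eLpNorm r 2 μ) := by
  have h := eLpNorm_smul_le_mul_eLpNorm (p := 2) (q := 2) (r := 1) hr hf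
  calc ‖∫ o, u o * f o * r o ∂μ‖ₑ ≤ ∫⁻ o, ‖u o * f o * r o‖ₑ ∂μ :=
        enorm_integral_le_lintegral_enorm _
    _ ≤ ∫⁻ o, ENNReal.ofReal K * ‖f o * r o‖ₑ ∂μ := by
        refine lintegral_mono fun o => ?_
        rw [mul_assoc, enorm_mul]
        gcongr
        rw [Real.enorm_eq_ofReal_abs]
        exact ENNReal.ofReal_le_ofReal (hu o)
    _ = ENNReal.ofReal K * ∫⁻ o, ‖f o * r o‖ₑ ∂μ :=
        lintegral_const_mul' _ _ ENNReal.ofReal_ne_top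
    _ ≤ _ := by
        gcongr
        simpa [eLpNorm_one_eq_lintegral_enorm] using h

lemma integral_eq_integral_mul_rnDeriv {μ ν : Measure O} [IsFiniteMeasure μ]
    [IsFiniteMeasure ν] (hμν : μ ≪ ν) (f : O → ℝ) :
    ∫ o, f o ∂μ = ∫ o, f o * (μ.rnDeriv ν o).toReal ∂ν := by
  rw [← integral_rnDeriv_smul hμν]
  simp_rw [smul_eq_mul, mul_comm]

lemma integrable_of_memLp_rnDeriv {μ ν : Measure O} [IsFiniteMeasure μ] [IsFiniteMeasure ν]
    (hμν : μ ≪ ν) (hq : MemLp (fun o => (μ.rnDeriv ν o).toReal) 2 ν) {f : O → ℝ}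
    (hf : MemLp f 2 ν) : Integrable f μ := by
  rw [← integrable_rnDeriv_smul_iff hμν]
  exact hq.integrable_mul hf

namespace IsDifferentiablePath

variable {P : Measure O} {Q : ℝ → Measure O} {s : O → ℝ}

lemma isProbabilityMeasure_base (h : IsDifferentiablePath P Q s) : IsProbabilityMeasure P :=
  h.zero ▸ h.isProbabilityMeasure.self_of_nhds

lemma memLp_rnDeriv (h : IsDifferentiablePath P Q s) :
    ∀ᶠ ε in 𝓝 (0 : ℝ), MemLp (fun o => ((Q ε).rnDeriv P o).toReal) 2 P := by
  have := h.isProbabilityMeasure_base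
  have hpunct : ∀ᶠ ε in 𝓝[≠] (0 : ℝ), MemLp (fun o => ((Q ε).rnDeriv P o).toReal) 2 P := by
    filter_upwards [h.tendsto_score.eventually (gt_mem_nhds one_pos),
      self_mem_nhdsWithin] with ε hε hne
    have hne : ε ≠ 0 := hne
    have hq : AEStronglyMeasurable (fun o => ((Q ε).rnDeriv P o).toReal) P :=
      ((Measure.measurable_rnDeriv _ _).ennreal_toReal).aestronglyMeasurable
    have hd : MemLp (fun o => ε⁻¹ * (((Q ε).rnDeriv P o).toReal - 1) - s o) 2 P :=
      ⟨((hq.sub aestronglyMeasurable_const).const_mul _).sub h.memLp_score.1,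
        hε.trans ENNReal.one_lt_top⟩
    refine (((hd.add h.memLp_score).const_mul ε).add (memLp_const 1)).ae_eq
      (Eventually.of_forall fun o => ?_)
    simp only [Pi.add_apply, sub_add_cancel]
    rw [mul_inv_cancel_left₀ hne, sub_add_cancel]
  rw [eventually_nhdsWithin_iff] at hpunct
  filter_upwards [hpunct] with ε hε
  rcases eq_or_ne ε 0 with rfl | hne
  · rw [h.zero]
    refine (memLp_const (1 : ℝ)).ae_eq ?_
    filter_upwards [Measure.rnDeriv_self P] with o ho
    simp [ho]
  · exact hε hne

/-- Along a differentiable path the likelihood ratio tends to `1` in `L¹`. -/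
lemma tendsto_integral_abs_sub_one (h : IsDifferentiablePath P Q s) :
    Tendsto (fun ε => ∫ o, |((Q ε).rnDeriv P o).toReal - 1| ∂P) (𝓝[≠] 0) (𝓝 0) := by
  have := h.isProbabilityMeasure_base
  have hlim : Tendsto (fun ε : ℝ => |ε| * (1 + ∫ o, |s o| ∂P)) (𝓝[≠] 0) (𝓝 0) := by
    have : Tendsto (fun ε : ℝ => |ε| * (1 + ∫ o, |s o| ∂P)) (𝓝 0)
        (𝓝 (|0| * (1 + ∫ o, |s o| ∂P))) := by
      exact (continuous_abs.mul continuous_const).tendsto 0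
    simpa using this.mono_left nhdsWithin_le_nhds
  refine squeeze_zero' (Eventually.of_forall fun ε => integral_nonneg fun o => abs_nonneg _) ?_
    hlim
  filter_upwards [h.tendsto_score.eventually (gt_mem_nhds one_pos),
    self_mem_nhdsWithin, h.memLp_rnDeriv.filter_mono nhdsWithin_le_nhds] with ε hε hne hq
  have hne : ε ≠ 0 := hne
  set d : O → ℝ := fun o => ε⁻¹ * (((Q ε).rnDeriv P o).toReal - 1) - s o with hd
  have hdm : MemLp d 2 P := ((hq.sub (memLp_const 1)).const_mul _).sub h.memLp_score
  have hd1 : ∫ o, |d o| ∂P ≤ 1 := by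
    have e1 : eLpNorm d 1 P ≤ eLpNorm d 2 P :=
      eLpNorm_le_eLpNorm_of_exponent_le (by norm_num) hdm.1
    have e2 : ∫ o, |d o| ∂P = (eLpNorm d 1 P).toReal := by
      rw [eLpNorm_one_eq_lintegral_enorm, ← integral_norm_eq_lintegral_enorm hdm.1]
      rfl
    rw [e2]
    exact ENNReal.toReal_le_of_le_ofReal zero_le_one (by simpa using e1.trans hε.le)
  have hds : Integrable d P := hdm.integrable (by norm_num)
  have hss : Integrable s P := h.memLp_score.integrable (by norm_num)
  calc ∫ o, |((Q ε).rnDeriv P o).toReal - 1| ∂P = ∫ o, |ε| * |d o + s o| ∂P := by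
        congr 1 with o
        rw [← abs_mul, hd]
        congr 1
        field_simp
        ring
    _ ≤ ∫ o, |ε| * (|d o| + |s o|) ∂P := by
        refine integral_mono ((hds.add hss).norm.const_mul _)
          ((hds.norm.add hss.norm).const_mul _) fun o => ?_
        exact mul_le_mul_of_nonneg_left (abs_add_le _ _) (abs_nonneg _)
    _ = |ε| * (∫ o, |d o| ∂P + ∫ o, |s o| ∂P) := by
        rw [integral_const_mul]
        congr 1
        exact integral_add hds.norm hss.norm
    _ ≤ _ := by gcongr

/-- The derivative of `E_{Q ε}[u_ε f]` along a differentiable path, for bounded multipliers `u_ε`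
that are continuous in `L¹` at `0`. If `E_P[u_ε f]` does not depend on `ε`, the dependence of
`u_ε` on `ε` contributes nothing to the derivative. -/
theorem hasDerivAt_integral_mul (h : IsDifferentiablePath P Q s) {u : ℝ → O → ℝ} {f : O → ℝ}
    {K a : ℝ} (hf : MemLp f 2 P) (hu : ∀ᶠ ε in 𝓝 (0 : ℝ), AEStronglyMeasurable (u ε) P)
    (hK : ∀ᶠ ε in 𝓝 (0 : ℝ), ∀ o, |u ε o| ≤ K)
    (hconst : ∀ᶠ ε in 𝓝 (0 : ℝ), ∫ o, u ε o * f o ∂P = a)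
    (hlim : Tendsto (fun ε => ∫ o, |u ε o - u 0 o| ∂P) (𝓝[≠] 0) (𝓝 0)) :
    HasDerivAt (fun ε => ∫ o, u ε o * f o ∂(Q ε)) (∫ o, u 0 o * f o * s o ∂P) 0 := by
  have := h.isProbabilityMeasure_base
  have hu0 := hu.self_of_nhds
  have hK0 := hK.self_of_nhds
  have hfs : Integrable (fun o => f o * s o) P := hf.integrable_mul h.memLp_score
  -- The slope is `E[u_ε f R_ε]`, where `R_ε` is the difference quotient of the likelihood ratio.
  set R : ℝ → O → ℝ := fun ε o => ε⁻¹ * (((Q ε).rnDeriv P o).toReal - 1) with hR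
  have h1 : Tendsto (fun ε => ∫ o, u ε o * f o * (R ε o - s o) ∂P) (𝓝[≠] 0) (𝓝 0) := by
    rw [tendsto_zero_iff_enorm_tendsto_zero]
    have hb : Tendsto (fun ε => ENNReal.ofReal K *
        (eLpNorm f 2 P * eLpNorm (fun o => R ε o - s o) 2 P)) (𝓝[≠] 0) (𝓝 0) := by
      have := ENNReal.Tendsto.const_mul (a := ENNReal.ofReal K)
        (ENNReal.Tendsto.const_mul (a := eLpNorm f 2 P) h.tendsto_score (Or.inr hf.2.ne))
        (Or.inr ENNReal.ofReal_ne_top)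
      simpa using this
    refine tendsto_of_tendsto_of_tendsto_of_le_of_le' tendsto_const_nhds hb
      (Eventually.of_forall fun _ => zero_le) ?_
    filter_upwards [hK.filter_mono nhdsWithin_le_nhds,
      h.memLp_rnDeriv.filter_mono nhdsWithin_le_nhds] with ε hKε hq
    exact enorm_integral_mul_le hKε hf.1
      (((hq.1.sub aestronglyMeasurable_const).const_mul _).sub h.memLp_score.1)
  have h2 : Tendsto (fun ε => ∫ o, (u ε o - u 0 o) * (f o * s o) ∂P) (𝓝[≠] 0) (𝓝 0) := by
    refine tendsto_integral_mul_of_bounded (K := K + K) hfs ?_ ?_ hlim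
    · filter_upwards [hu.filter_mono nhdsWithin_le_nhds] with ε hε using hε.sub hu0
    · filter_upwards [hK.filter_mono nhdsWithin_le_nhds] with ε hε o
      exact (abs_sub _ _).trans (add_le_add (hε o) (hK0 o))
  rw [hasDerivAt_iff_tendsto_slope]
  have h3 := (h1.add h2).add_const (∫ o, u 0 o * f o * s o ∂P)
  rw [zero_add, zero_add] at h3
  refine h3.congr' ?_
  filter_upwards [self_mem_nhdsWithin, hu.filter_mono nhdsWithin_le_nhds,
    hK.filter_mono nhdsWithin_le_nhds, hconst.filter_mono nhdsWithin_le_nhds,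
    h.memLp_rnDeriv.filter_mono nhdsWithin_le_nhds,
    h.isProbabilityMeasure.filter_mono nhdsWithin_le_nhds,
    h.absolutelyContinuous.filter_mono nhdsWithin_le_nhds] with ε hne huε hKε hcε hq hpr hac
  have huf : MemLp (fun o => u ε o * f o) 2 P :=
    hf.of_le_mul (huε.mul hf.1) (c := K) (Eventually.of_forall fun o => by
      rw [norm_mul]; exact mul_le_mul_of_nonneg_right (hKε o) (norm_nonneg _))
  have hu0f : MemLp (fun o => u 0 o * f o) 2 P :=
    hf.of_le_mul (hu0.mul hf.1) (c := K) (Eventually.of_forall fun o => by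
      rw [norm_mul]; exact mul_le_mul_of_nonneg_right (hK0 o) (norm_nonneg _))
  have hRm : MemLp (R ε) 2 P := (hq.sub (memLp_const 1)).const_mul _
  have i1 : Integrable (fun o => u ε o * f o * (R ε o - s o)) P :=
    huf.integrable_mul (hRm.sub h.memLp_score)
  have i2 : Integrable (fun o => u 0 o * f o * s o) P := hu0f.integrable_mul h.memLp_score
  have i3 : Integrable (fun o => u ε o * f o * s o) P := huf.integrable_mul h.memLp_score
  have i4 : Integrable (fun o => (u ε o - u 0 o) * (f o * s o)) P :=
    (i3.sub i2).congr (Eventually.of_forall fun o => by simp only [Pi.sub_apply]; ring)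
  have i7 : Integrable (fun o => u ε o * f o * (R ε o - s o) +
      (u ε o - u 0 o) * (f o * s o)) P := i1.add i4
  have i5 : Integrable (fun o => u ε o * f o) P := huf.integrable (by norm_num)
  have i6 : Integrable (fun o => u ε o * f o * ((Q ε).rnDeriv P o).toReal) P :=
    huf.integrable_mul hq
  rw [← integral_add i1 i4, ← integral_add i7 i2, slope_def_field, sub_zero, h.zero,
    hconst.self_of_nhds, ← hcε, integral_eq_integral_mul_rnDeriv hac, ← integral_sub i6 i5,
    div_eq_inv_mul, ← integral_const_mul]
  congr 1 with o
  simp only [hR]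
  ring

end IsDifferentiablePath

end Semiparametric

/-! ### Balancing weights -/

namespace Semiparametric

variable {Ω : Type*} {m mΩ : MeasurableSpace Ω} {μ : Measure Ω} {E C : Set Ω}

lemma integral_cond_eq (A : Set Ω) (f : Ω → ℝ) :
    ∫ x, f x ∂(cond μ A) = (μ.real A)⁻¹ * ∫ x in A, f x ∂μ := by
  rw [ProbabilityTheory.cond, integral_smul_measure, ENNReal.toReal_inv, smul_eq_mul,
    measureReal_def]

lemma restrict_eq_smul_cond [IsFiniteMeasure μ] {A : Set Ω} (hA : μ A ≠ 0) :
    μ.restrict A = μ A • cond μ A := by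
  rw [ProbabilityTheory.cond, smul_smul, ENNReal.mul_inv_cancel hA (measure_ne_top μ A), one_smul]

lemma integrable_cond {A : Set Ω} (hA : μ A ≠ 0) {f : Ω → ℝ} (hf : IntegrableOn f A μ) :
    Integrable f (cond μ A) :=
  hf.smul_measure (ENNReal.inv_ne_top.2 hA)

lemma integrableOn_of_integrable_cond [IsFiniteMeasure μ] {A : Set Ω} (hA : μ A ≠ 0)
    {f : Ω → ℝ} (hf : Integrable f (cond μ A)) : IntegrableOn f A μ := by
  rw [IntegrableOn, restrict_eq_smul_cond hA]
  exact hf.smul_measure (measure_ne_top μ A)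

lemma integral_mul_condExp [IsFiniteMeasure μ] (hm : m ≤ mΩ) {h f : Ω → ℝ} {K : ℝ}
    (hh : StronglyMeasurable[m] h) (hK : ∀ x, |h x| ≤ K) (hf : Integrable f μ) :
    ∫ x, h x * (μ[f|m]) x ∂μ = ∫ x, h x * f x ∂μ := by
  have h1 := condExp_stronglyMeasurable_mul_of_bound hm hh hf K (Eventually.of_forall hK)
  have h2 := integral_condExp hm (μ := μ) (f := h * f)
  rw [integral_congr_ae h1] at h2
  exact h2

lemma setIntegral_mul_condExp_cond [IsFiniteMeasure μ] (hm : m ≤ mΩ) {A : Set Ω} (hA : μ A ≠ 0)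
    {h f : Ω → ℝ} {K : ℝ} (hh : StronglyMeasurable[m] h) (hK : ∀ x, |h x| ≤ K)
    (hf : IntegrableOn f A μ) :
    ∫ x in A, h x * ((cond μ A)[f|m]) x ∂μ = ∫ x in A, h x * f x ∂μ := by
  have h1 := integral_mul_condExp hm hh hK (integrable_cond hA hf)
  rw [integral_cond_eq, integral_cond_eq] at h1
  exact mul_left_cancel₀ (inv_ne_zero
    ((measureReal_ne_zero_iff (measure_ne_top μ A)).2 hA)) h1

/-- `w` is a bounded nonnegative `m`-measurable weight that, applied to the units in `C`,
reproduces the distribution of the units in `E` on the σ-algebra `m`. With `m` generated by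
the covariates, it is a version of the odds of `E` against `C` given the covariates. -/
structure IsBalancingWeight (m : MeasurableSpace Ω) {mΩ : MeasurableSpace Ω} (μ : Measure Ω)
    (E C : Set Ω) (K : ℝ) (w : Ω → ℝ) : Prop where
  stronglyMeasurable : StronglyMeasurable[m] w
  nonneg : ∀ x, 0 ≤ w x
  le : ∀ x, w x ≤ K
  setLIntegral_eq : ∀ S, MeasurableSet[m] S →
    ∫⁻ x in S ∩ C, ENNReal.ofReal (w x) ∂μ = μ (S ∩ E)

namespace IsBalancingWeight

variable {K : ℝ} {w h : Ω → ℝ}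

lemma abs_le (hw : IsBalancingWeight m μ E C K w) (x : Ω) : |w x| ≤ K := by
  rw [abs_of_nonneg (hw.nonneg x)]; exact hw.le x

lemma trim_eq (hw : IsBalancingWeight m μ E C K w) (hm : m ≤ mΩ) :
    ((μ.restrict C).withDensity fun x => ENNReal.ofReal (w x)).trim hm =
      (μ.restrict E).trim hm := by
  refine @Measure.ext _ m _ _ fun S hS => ?_
  rw [trim_measurableSet_eq hm hS, trim_measurableSet_eq hm hS, withDensity_apply _ (hm S hS),
    Measure.restrict_restrict (hm S hS), Measure.restrict_apply (hm S hS), hw.setLIntegral_eq S hS]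

lemma setIntegral_eq (hw : IsBalancingWeight m μ E C K w) (hm : m ≤ mΩ)
    (hh : StronglyMeasurable[m] h) : ∫ x in E, h x ∂μ = ∫ x in C, w x * h x ∂μ := by
  rw [integral_trim hm hh, ← hw.trim_eq hm, ← integral_trim hm hh,
    integral_withDensity_eq_integral_toReal_smul
      (hw.stronglyMeasurable.mono hm).measurable.ennreal_ofReal
      (Eventually.of_forall fun _ => ENNReal.ofReal_lt_top)]
  simp_rw [ENNReal.toReal_ofReal (hw.nonneg _), smul_eq_mul]

lemma integrableOn (hw : IsBalancingWeight m μ E C K w) (hm : m ≤ mΩ)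
    (hh : StronglyMeasurable[m] h) (hi : IntegrableOn h C μ) : IntegrableOn h E μ := by
  refine integrable_of_integrable_trim hm ?_
  rw [← hw.trim_eq hm]
  refine Integrable.trim hm ?_ hh
  rw [integrable_withDensity_iff_integrable_smul'
    (hw.stronglyMeasurable.mono hm).measurable.ennreal_ofReal
    (Eventually.of_forall fun _ => ENNReal.ofReal_lt_top)]
  simp_rw [ENNReal.toReal_ofReal (hw.nonneg _), smul_eq_mul]
  exact hi.bdd_mul (hw.stronglyMeasurable.mono hm).aestronglyMeasurable
    (Eventually.of_forall hw.abs_le)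

lemma memLp_two (hw : IsBalancingWeight m μ E C K w) (hm : m ≤ mΩ)
    (hh : StronglyMeasurable[m] h) (hi : MemLp h 2 (μ.restrict C)) :
    MemLp h 2 (μ.restrict E) := by
  rw [memLp_two_iff_integrable_sq (hh.mono hm).aestronglyMeasurable] at hi ⊢
  exact hw.integrableOn hm (hh.pow 2) hi

/-- The signed weight `1_E - w 1_C`, which contrasts the units in `E` with the reweighted units
in `C`. -/
noncomputable def contrast (E C : Set Ω) (w : Ω → ℝ) (x : Ω) : ℝ :=
  E.indicator (fun _ => 1) x - C.indicator w x

lemma abs_contrast_le (hw : IsBalancingWeight m μ E C K w) (x : Ω) :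
    |contrast E C w x| ≤ 1 + K := by
  have hK : 0 ≤ K := (hw.nonneg x).trans (hw.le x)
  refine (abs_sub _ _).trans (add_le_add ?_ ?_)
  · by_cases hx : x ∈ E <;> simp [hx]
  · by_cases hx : x ∈ C <;> simp [hx, hw.abs_le x, hK]

lemma measurable_contrast (hw : IsBalancingWeight m μ E C K w) (hm : m ≤ mΩ)
    (hE : MeasurableSet E) (hC : MeasurableSet C) : Measurable (contrast E C w) :=
  (measurable_const.indicator hE).sub ((hw.stronglyMeasurable.mono hm).measurable.indicator hC)

lemma integral_contrast_mul (hwm : Measurable w) (hwK : ∀ x, |w x| ≤ K)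
    (hE : MeasurableSet E) (hC : MeasurableSet C) {f : Ω → ℝ} (hfE : IntegrableOn f E μ)
    (hfC : IntegrableOn f C μ) :
    ∫ x, contrast E C w x * f x ∂μ = ∫ x in E, f x ∂μ - ∫ x in C, w x * f x ∂μ := by
  have hwf : IntegrableOn (fun x => w x * f x) C μ :=
    hfC.bdd_mul hwm.aestronglyMeasurable (Eventually.of_forall hwK)
  rw [← integral_indicator hE, ← integral_indicator hC, ← integral_sub
    ((integrable_indicator_iff hE).2 hfE) ((integrable_indicator_iff hC).2 hwf)]
  congr 1 with x
  by_cases h1 : x ∈ E <;> by_cases h2 : x ∈ C <;> simp [contrast, h1, h2, sub_mul]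

/-- The average over `E` of the contrast between the conditional means of `V` in `E` and in `C`
is a contrast of weighted means of `V - g`, for any `m`-measurable `g`: the balancing property
cancels `g`. -/
theorem integral_condExp_sub_condExp [IsFiniteMeasure μ] (hw : IsBalancingWeight m μ E C K w)
    (hm : m ≤ mΩ) (hE : MeasurableSet E) (hC : MeasurableSet C) (hE0 : μ E ≠ 0) (hC0 : μ C ≠ 0)
    {V g : Ω → ℝ} (hV : Integrable V μ) (hg : StronglyMeasurable[m] g)
    (hgC : IntegrableOn g C μ) :
    ∫ x, (((cond μ E)[V|m]) x - ((cond μ C)[V|m]) x) ∂(cond μ E) =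
      (μ.real E)⁻¹ * ∫ x, contrast E C w x * (V x - g x) ∂μ := by
  have hgE := hw.integrableOn hm hg hgC
  have hmC : IntegrableOn ((cond μ C)[V|m]) C μ :=
    integrableOn_of_integrable_cond hC0 integrable_condExp
  have hmE : IntegrableOn ((cond μ C)[V|m]) E μ :=
    hw.integrableOn hm stronglyMeasurable_condExp hmC
  have hwi : ∀ f : Ω → ℝ, IntegrableOn f C μ → IntegrableOn (fun x => w x * f x) C μ :=
    fun f hf => hf.bdd_mul (hw.stronglyMeasurable.mono hm).aestronglyMeasurable
      (Eventually.of_forall hw.abs_le)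
  have e1 : ∫ x in E, ((cond μ C)[V|m]) x ∂μ = ∫ x in C, w x * V x ∂μ := by
    rw [hw.setIntegral_eq hm stronglyMeasurable_condExp]
    exact setIntegral_mul_condExp_cond hm hC0 hw.stronglyMeasurable hw.abs_le hV.integrableOn
  have e2 : ∫ x in E, g x ∂μ = ∫ x in C, w x * g x ∂μ := hw.setIntegral_eq hm hg
  rw [integral_sub integrable_condExp (integrable_cond hE0 hmE), integral_condExp hm,
    integral_cond_eq, integral_cond_eq, ← mul_sub, e1]
  congr 1
  rw [integral_contrast_mul (f := fun x => V x - g x) (hw.stronglyMeasurable.mono hm).measurable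
    hw.abs_le hE hC (hV.integrableOn.sub hgE) (hV.integrableOn.sub hgC)]
  simp_rw [mul_sub]
  rw [integral_sub hV.integrableOn hgE, e2,
    integral_sub (hwi _ hV.integrableOn) (hwi _ hgC)]
  ring

/-- Stability of balancing weights in `L¹`: the difference of the weights for two distributions
is tested against its sign, which the balancing property turns into a difference of the
distributions. -/
theorem setIntegral_abs_sub_le {P Q : Measure Ω} [IsFiniteMeasure P] [IsFiniteMeasure Q]
    {w w' : Ω → ℝ} (hm : m ≤ mΩ) (hE : MeasurableSet E) (hC : MeasurableSet C)
    (hw : IsBalancingWeight m P E C K w) (hw' : IsBalancingWeight m Q E C K w') (hQP : Q ≪ P)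
    (hK : 0 ≤ K) :
    ∫ x in C, |w' x - w x| ∂P ≤ (K + 1) * ∫ x, |(Q.rnDeriv P x).toReal - 1| ∂P := by
  set q : Ω → ℝ := fun x => (Q.rnDeriv P x).toReal with hq
  have hqi : Integrable q P := Measure.integrable_toReal_rnDeriv
  have hdi : Integrable (fun x => |q x - 1|) P := (hqi.sub (integrable_const 1)).norm
  set h : Ω → ℝ := fun x => (SignType.sign (w' x - w x) : ℝ) with hh
  have hsign : ∀ y : ℝ, |(SignType.sign y : ℝ)| ≤ 1 := fun y => by
    rcases lt_trichotomy y 0 with hy | rfl | hy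
    · simp [sign_neg hy]
    · simp
    · simp [sign_pos hy]
  have hh1 : ∀ x, |h x| ≤ 1 := fun x => hsign _
  have hhm : StronglyMeasurable[m] h := by
    have : Measurable[m] fun x => w' x - w x :=
      (hw'.stronglyMeasurable.sub hw.stronglyMeasurable).measurable
    have hs : Measurable fun y : ℝ => (SignType.sign y : ℝ) := by
      have : (fun y : ℝ => (SignType.sign y : ℝ)) =
          fun y => if 0 < y then 1 else if y < 0 then -1 else 0 := by
        funext y
        rw [sign_apply]; split_ifs <;> simp
      rw [this]
      exact Measurable.ite measurableSet_Ioi measurable_const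
        (Measurable.ite measurableSet_Iio measurable_const measurable_const)
    exact (hs.comp this).stronglyMeasurable
  have hhP : ∀ ν : Measure Ω, AEStronglyMeasurable h ν :=
    fun ν => (hhm.mono hm).aestronglyMeasurable
  have hwh : ∀ {v : Ω → ℝ}, (∀ x, |v x| ≤ K) → ∀ x, |v x * h x| ≤ K := fun {v} hv x => by
    rw [abs_mul]
    exact (mul_le_of_le_one_right (abs_nonneg _) (hh1 x)).trans (hv x)
  have hbi : ∀ {ν : Measure Ω} [IsFiniteMeasure ν] {v : Ω → ℝ}, StronglyMeasurable[m] v →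
      (∀ x, |v x| ≤ K) → Integrable (fun x => v x * h x) ν := fun {ν} _ {v} hv hb =>
    Integrable.of_bound ((hv.mul hhm).mono hm).aestronglyMeasurable K
      (Eventually.of_forall (hwh hb))
  have iw := hbi (ν := P.restrict C) hw.stronglyMeasurable hw.abs_le
  have iw' := hbi (ν := P.restrict C) hw'.stronglyMeasurable hw'.abs_le
  have e1 : ∫ x in C, |w' x - w x| ∂P
      = ∫ x in C, w' x * h x ∂P - ∫ x in E, h x ∂P := by
    rw [hw.setIntegral_eq hm hhm, ← integral_sub iw' iw]
    congr 1 with x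
    rw [← sub_mul, hh, mul_comm]
    exact (sign_mul_self (w' x - w x)).symm
  have hmulq : ∀ {f : Ω → ℝ} {A : Set Ω}, MeasurableSet A →
      ∫ x in A, f x ∂Q = ∫ x in A, f x * q x ∂P := fun {f A} hA => by
    rw [← integral_indicator hA, integral_eq_integral_mul_rnDeriv hQP, ← integral_indicator hA]
    congr 1 with x
    by_cases hx : x ∈ A <;> simp [hx, hq]
  have e2 : ∫ x in C, w' x * h x * q x ∂P = ∫ x in E, h x * q x ∂P := by
    rw [← hmulq hC, ← hmulq hE, hw'.setIntegral_eq hm hhm]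
  have ihE : Integrable h (P.restrict E) :=
    Integrable.of_bound (hhP _) 1 (Eventually.of_forall hh1)
  have ihqE : Integrable (fun x => h x * q x) (P.restrict E) :=
    hqi.restrict.bdd_mul (hhP _) (Eventually.of_forall hh1)
  have iwqC : Integrable (fun x => w' x * h x * q x) (P.restrict C) :=
    hqi.restrict.bdd_mul ((hw'.stronglyMeasurable.mul hhm).mono hm).aestronglyMeasurable
      (Eventually.of_forall (hwh hw'.abs_le))
  have hmono : ∀ A : Set Ω, ∫ x in A, |q x - 1| ∂P ≤ ∫ x, |q x - 1| ∂P := fun A =>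
    setIntegral_le_integral hdi (Eventually.of_forall fun _ => abs_nonneg _)
  have e3 : ∫ x in C, w' x * h x ∂P - ∫ x in C, w' x * h x * q x ∂P
      ≤ K * ∫ x, |q x - 1| ∂P := by
    rw [← integral_sub iw' iwqC]
    refine le_trans (integral_mono (iw'.sub iwqC) (hdi.restrict.const_mul K) fun x => ?_)
      ((integral_const_mul K _).trans_le (mul_le_mul_of_nonneg_left (hmono C) hK))
    calc w' x * h x - w' x * h x * q x = w' x * h x * (1 - q x) := by ring
      _ ≤ |w' x * h x| * |1 - q x| := by rw [← abs_mul]; exact le_abs_self _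
      _ ≤ K * |q x - 1| := by
          rw [abs_sub_comm]
          exact mul_le_mul_of_nonneg_right (hwh hw'.abs_le x)
            (abs_nonneg _)
  have e4 : ∫ x in E, h x * q x ∂P - ∫ x in E, h x ∂P ≤ ∫ x, |q x - 1| ∂P := by
    rw [← integral_sub ihqE ihE]
    refine le_trans (integral_mono (ihqE.sub ihE) hdi.restrict fun x => ?_) (hmono E)
    calc h x * q x - h x = h x * (q x - 1) := by ring
      _ ≤ |h x| * |q x - 1| := by rw [← abs_mul]; exact le_abs_self _
      _ ≤ |q x - 1| := mul_le_of_le_one_left (abs_nonneg _) (hh1 x)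
  rw [e1]
  linarith

end IsBalancingWeight

/-- The odds `p / (1 - p)` after clipping the propensity score `p` to `[0, 1 - c]`. -/
noncomputable def clippedOdds (c : ℝ) (p : Ω → ℝ) (x : Ω) : ℝ :=
  max 0 (min (p x) (1 - c)) / (1 - max 0 (min (p x) (1 - c)))

/-- Under overlap, the odds of the propensity score are a balancing weight. -/
theorem isBalancingWeight_clippedOdds [IsFiniteMeasure μ] (hm : m ≤ mΩ) (hE : MeasurableSet E)
    (hC : MeasurableSet C) (hdisj : Disjoint E C) (hE0 : μ E ≠ 0) {c : ℝ} (hc : 0 < c)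
    (hc1 : c < 1)
    (hover : ∀ᵐ x ∂(cond μ (E ∪ C)), ((cond μ (E ∪ C))[E.indicator (fun _ => (1 : ℝ))|m]) x
      < 1 - c) :
    IsBalancingWeight m μ E C ((1 - c) / c)
        (clippedOdds c ((cond μ (E ∪ C))[E.indicator (fun _ => (1 : ℝ))|m])) ∧
      ∀ᵐ x ∂μ, x ∈ C → clippedOdds c ((cond μ (E ∪ C))[E.indicator (fun _ => (1 : ℝ))|m]) x =
        ((cond μ (E ∪ C))[E.indicator (fun _ => (1 : ℝ))|m]) x /
          (1 - ((cond μ (E ∪ C))[E.indicator (fun _ => (1 : ℝ))|m]) x) := by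
  set A := E ∪ C with hAdef
  set ν := cond μ A with hν
  have hA : MeasurableSet A := hE.union hC
  have hA0 : μ A ≠ 0 := fun h0 => hE0 (measure_mono_null Set.subset_union_left h0)
  set p := ν[E.indicator (fun _ => (1 : ℝ))|m] with hp
  set w := clippedOdds c p with hwdef
  set r : Ω → ℝ := fun x => max 0 (min (p x) (1 - c)) with hr
  have hr0 : ∀ x, 0 ≤ r x := fun x => le_max_left _ _
  have hr1 : ∀ x, r x ≤ 1 - c := fun x => max_le (by linarith) (min_le_right _ _)
  have hrm : Measurable[m] r := by
    have : Measurable[m] p := stronglyMeasurable_condExp.measurable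
    exact measurable_const.max (this.min measurable_const)
  have hw_eq : ∀ x, w x = r x / (1 - r x) := fun x => rfl
  have hpos : ∀ x, 0 < 1 - r x := fun x => by linarith [hr1 x]
  have hwm : StronglyMeasurable[m] w :=
    (hrm.div (measurable_const.sub hrm)).stronglyMeasurable
  have hw0 : ∀ x, 0 ≤ w x := fun x => div_nonneg (hr0 x) (hpos x).le
  have hwK : ∀ x, w x ≤ (1 - c) / c := fun x => by
    rw [hw_eq]
    exact div_le_div₀ (by linarith) (hr1 x) hc (by linarith [hr1 x])
  have hp0 : 0 ≤ᵐ[ν] p := condExp_nonneg (Eventually.of_forall fun x =>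
    Set.indicator_nonneg (fun _ _ => zero_le_one) x)
  have hrp : ∀ᵐ x ∂ν, r x = p x := by
    filter_upwards [hover, hp0] with x hx hx0
    simp only [hr]
    rw [min_eq_left hx.le, max_eq_right (show 0 ≤ p x from hx0)]
  refine ⟨⟨hwm, hw0, hwK, fun S hS => ?_⟩, ?_⟩
  · -- The defining property of `p`, tested against `1_S (1 + w) = 1_S / (1 - p)`.
    have hb : ∀ x, |S.indicator (fun x => 1 + w x) x| ≤ 1 + (1 - c) / c := fun x => by
      have hK0 : 0 ≤ (1 - c) / c := (hw0 x).trans (hwK x)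
      by_cases hx : x ∈ S
      · rw [Set.indicator_of_mem hx, abs_of_nonneg (by linarith [hw0 x])]
        linarith [hwK x]
      · rw [Set.indicator_of_notMem hx, abs_zero]
        linarith
    have hkey := setIntegral_mul_condExp_cond (h := S.indicator fun x => 1 + w x) hm hA0
      ((stronglyMeasurable_const.add hwm).indicator hS) hb
      (((integrable_const (1 : ℝ)).indicator hE).integrableOn : IntegrableOn _ A μ)
    have hwi : Integrable w μ := Integrable.of_bound (hwm.mono hm).aestronglyMeasurable _
      (Eventually.of_forall fun x => by
        rw [Real.norm_eq_abs, abs_of_nonneg (hw0 x)]; exact hwK x)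
    have hSm := hm S hS
    have hrpA : ∀ᵐ x ∂(μ.restrict A), r x = p x := by
      rw [restrict_eq_smul_cond hA0]
      exact Measure.ae_smul_measure hrp _
    have e1 : ∫ x in A, S.indicator (fun x => 1 + w x) x * p x ∂μ = ∫ x in S ∩ A, w x ∂μ := by
      rw [← Measure.restrict_restrict hSm, ← integral_indicator hSm]
      refine integral_congr_ae ?_
      filter_upwards [hrpA] with x hx
      by_cases hxS : x ∈ S
      · simp only [Set.indicator_of_mem hxS]
        rw [← hx, hw_eq]
        have := (hpos x).ne'
        field_simp
        ring
      · simp [hxS]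
    have e2 : ∫ x in A, S.indicator (fun x => 1 + w x) x * E.indicator (fun _ => (1 : ℝ)) x ∂μ
        = ∫ x in S ∩ E, (1 + w x) ∂μ := by
      rw [← integral_indicator (hSm.inter hE), ← integral_indicator hA]
      congr 1 with x
      by_cases hxS : x ∈ S <;> by_cases hxE : x ∈ E <;> simp [hxS, hxE, hAdef]
    have e3 : ∫ x in S ∩ A, w x ∂μ = ∫ x in S ∩ E, w x ∂μ + ∫ x in S ∩ C, w x ∂μ := by
      rw [hAdef, Set.inter_union_distrib_left]
      exact setIntegral_union (hdisj.mono Set.inter_subset_right Set.inter_subset_right)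
        (hSm.inter hC) hwi.integrableOn hwi.integrableOn
    rw [e1, e2, e3, integral_add (integrable_const 1) hwi.integrableOn] at hkey
    have hfin : ∫ x in S ∩ C, w x ∂μ = μ.real (S ∩ E) := by
      have : ∫ x in S ∩ E, (1 : ℝ) ∂μ = μ.real (S ∩ E) := by simp
      linarith
    rw [← ofReal_integral_eq_lintegral_ofReal hwi.integrableOn (Eventually.of_forall hw0), hfin,
      ofReal_measureReal]
  · have hrpA : ∀ᵐ x ∂(μ.restrict A), r x = p x := by
      rw [restrict_eq_smul_cond hA0]
      exact Measure.ae_smul_measure hrp _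
    rw [ae_restrict_iff' hA] at hrpA
    filter_upwards [hrpA] with x hx hxC
    rw [hw_eq, hx (Or.inr hxC)]

end Semiparametric

/-! ### Bounded perturbations of a distribution -/

namespace Semiparametric

section Tilt

lemma eventually_abs_mul_le {O : Type*} {s : O → ℝ} {B : ℝ} (hB : ∀ o, |s o| ≤ B) :
    ∀ᶠ ε in 𝓝 (0 : ℝ), ∀ o, |ε * s o| ≤ 1 / 2 := by
  have hlim : Tendsto (fun ε : ℝ => |ε| * |B|) (𝓝 0) (𝓝 (|0| * |B|)) :=
    (continuous_abs.mul continuous_const).tendsto 0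
  rw [abs_zero, zero_mul] at hlim
  filter_upwards [hlim.eventually (gt_mem_nhds (show (0 : ℝ) < 1 / 2 by norm_num))] with ε hε o
  rw [abs_mul]
  exact (mul_le_mul_of_nonneg_left ((hB o).trans (le_abs_self B)) (abs_nonneg _)).trans hε.le

variable {O : Type*} [MeasurableSpace O]

/-- The linear perturbation `(1 + ε s) P` of `P` in the direction `s`; for bounded `s` the density
is nonnegative when `ε` is small. -/
noncomputable def tilt (P : Measure O) (s : O → ℝ) (ε : ℝ) : Measure O :=
  P.withDensity fun o => ENNReal.ofReal (1 + ε * s o)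

variable {P : Measure O} {s : O → ℝ} {B : ℝ}

lemma tilt_absolutelyContinuous (P : Measure O) (s : O → ℝ) (ε : ℝ) : tilt P s ε ≪ P :=
  withDensity_absolutelyContinuous _ _

lemma tilt_le_smul {ε : ℝ} (hε : ∀ o, |ε * s o| ≤ 1 / 2) : tilt P s ε ≤ (2 : ENNReal) • P := by
  rw [tilt, ← withDensity_const]
  refine withDensity_mono (Eventually.of_forall fun o => ?_)
  refine ENNReal.ofReal_le_of_le_toReal ?_
  have := abs_le.1 (hε o)
  norm_num
  linarith

lemma le_smul_tilt {ε : ℝ} (hs : Measurable s) (hε : ∀ o, |ε * s o| ≤ 1 / 2) :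
    P ≤ (2 : ENNReal) • tilt P s ε := by
  rw [tilt, ← withDensity_smul _ (by fun_prop)]
  conv_lhs => rw [← withDensity_one (μ := P)]
  refine withDensity_mono (Eventually.of_forall fun o => ?_)
  have := abs_le.1 (hε o)
  have h2 : (2 : ENNReal) = ENNReal.ofReal 2 := by simp
  rw [Pi.one_apply, Pi.smul_apply, smul_eq_mul, h2, ← ENNReal.ofReal_mul (by norm_num)]
  rw [← ENNReal.ofReal_one]
  exact ENNReal.ofReal_le_ofReal (by linarith)

lemma isProbabilityMeasure_tilt [IsProbabilityMeasure P] {ε : ℝ} (hs : Integrable s P)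
    (hmean : ∫ o, s o ∂P = 0) (hε : ∀ o, |ε * s o| ≤ 1 / 2) :
    IsProbabilityMeasure (tilt P s ε) := by
  refine ⟨?_⟩
  rw [tilt, withDensity_apply _ MeasurableSet.univ, Measure.restrict_univ,
    ← ofReal_integral_eq_lintegral_ofReal]
  · rw [integral_add (integrable_const _) (hs.const_mul _), integral_const_mul, hmean]
    simp
  · exact (integrable_const _).add (hs.const_mul _)
  · exact Eventually.of_forall fun o => by
      have := abs_le.1 (hε o)
      simp only [Pi.zero_apply]
      linarith

lemma isDifferentiablePath_tilt [IsProbabilityMeasure P] (hs : Measurable s)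
    (hB : ∀ o, |s o| ≤ B) (hmean : ∫ o, s o ∂P = 0) :
    IsDifferentiablePath P (tilt P s) s where
  zero := by simp [tilt, withDensity_const]
  isProbabilityMeasure := by
    filter_upwards [eventually_abs_mul_le hB] with ε hε
    exact isProbabilityMeasure_tilt
      (Integrable.of_bound hs.aestronglyMeasurable B (Eventually.of_forall hB)) hmean hε
  absolutelyContinuous := Eventually.of_forall fun ε => tilt_absolutelyContinuous P s ε
  memLp_score := MemLp.of_bound hs.aestronglyMeasurable B (Eventually.of_forall hB)
  tendsto_score := by
    refine tendsto_const_nhds.congr' ?_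
    filter_upwards [(eventually_abs_mul_le hB).filter_mono nhdsWithin_le_nhds,
      self_mem_nhdsWithin] with ε hε hne
    have hne : ε ≠ 0 := hne
    have hm : Measurable fun o => ENNReal.ofReal (1 + ε * s o) := by fun_prop
    rw [← eLpNorm_zero (p := 2) (μ := P) (ε := ℝ)]
    refine eLpNorm_congr_ae ?_
    filter_upwards [Measure.rnDeriv_withDensity P hm] with o ho
    have := abs_le.1 (hε o)
    rw [tilt, ho, ENNReal.toReal_ofReal (by linarith), add_sub_cancel_left,
      inv_mul_cancel_left₀ hne, sub_self]
    rfl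

end Tilt

/-- Overlap survives, with a smaller constant, when a distribution is replaced by one whose
likelihood ratio lies between `1 / 2` and `2`. -/
theorem overlap_of_le_smul {Ω : Type*} {m mΩ : MeasurableSpace Ω} {P Q : Measure Ω}
    [IsFiniteMeasure P] [IsFiniteMeasure Q] {E C : Set Ω} {K : ℝ} {w : Ω → ℝ}
    (hw : IsBalancingWeight m P E C K w) (hm : m ≤ mΩ) (hE : MeasurableSet E)
    (hC : MeasurableSet C) (hdisj : Disjoint E C) (hK : 0 ≤ K) (hQP : Q ≤ (2 : ENNReal) • P)
    (hPQ : P ≤ (2 : ENNReal) • Q) (hE0 : Q E ≠ 0) :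
    ∀ᵐ x ∂(cond Q (E ∪ C)), ((cond Q (E ∪ C))[E.indicator (fun _ => (1 : ℝ))|m]) x
      < 1 - 1 / (2 + 4 * K) := by
  set A := E ∪ C with hAdef
  have hA : MeasurableSet A := hE.union hC
  have hA0 : Q A ≠ 0 := fun h0 => hE0 (measure_mono_null Set.subset_union_left h0)
  set p := (cond Q A)[E.indicator (fun _ => (1 : ℝ))|m] with hp
  set b : ℝ := 1 - 1 / (2 + 4 * K) with hb
  set S : Set Ω := {x | b ≤ p x} with hS
  have hpm : StronglyMeasurable[m] p := stronglyMeasurable_condExp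
  have hSm : MeasurableSet[m] S := measurableSet_le measurable_const hpm.measurable
  have hSm' := hm S hSm
  -- On the exceptional set `S`, treated units are at most `4 K` times as likely as controls.
  have hEC : Q.real (S ∩ E) ≤ 4 * K * Q.real (S ∩ C) := by
    have h1 : Q (S ∩ E) ≤ ENNReal.ofReal (4 * K) * Q (S ∩ C) := by
      calc Q (S ∩ E) ≤ 2 * P (S ∩ E) := by simpa using hQP (S ∩ E)
        _ = 2 * ∫⁻ x in S ∩ C, ENNReal.ofReal (w x) ∂P := by rw [hw.setLIntegral_eq S hSm]
        _ ≤ 2 * ∫⁻ x in S ∩ C, ENNReal.ofReal K ∂P := by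
            gcongr with x
            exact hw.le x
        _ = 2 * (ENNReal.ofReal K * P (S ∩ C)) := by rw [setLIntegral_const]
        _ ≤ 2 * (ENNReal.ofReal K * (2 * Q (S ∩ C))) := by
            gcongr
            simpa using hPQ (S ∩ C)
        _ = ENNReal.ofReal (4 * K) * Q (S ∩ C) := by
            rw [ENNReal.ofReal_mul (by norm_num), show ENNReal.ofReal 4 = 4 by simp,
              show (4 : ENNReal) = 2 * 2 by norm_num]
            ring
    have h2 := ENNReal.toReal_mono
      (ENNReal.mul_ne_top ENNReal.ofReal_ne_top (measure_ne_top Q _)) h1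
    rwa [ENNReal.toReal_mul, ENNReal.toReal_ofReal (by positivity)] at h2
  have hEi : Integrable (E.indicator fun _ => (1 : ℝ)) Q := (integrable_const 1).indicator hE
  have hkey := setIntegral_mul_condExp_cond (h := S.indicator fun _ => (1 : ℝ)) (K := 1) hm hA0
    (stronglyMeasurable_const.indicator hSm)
    (fun x => by by_cases hx : x ∈ S <;> simp [hx]) hEi.integrableOn
  have e1 : ∫ x in A, S.indicator (fun _ => (1 : ℝ)) x * E.indicator (fun _ => (1 : ℝ)) x ∂Q
      = Q.real (S ∩ E) := by
    rw [← integral_indicator hA, ← integral_indicator_one (hSm'.inter hE)]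
    congr 1 with x
    by_cases hxS : x ∈ S <;> by_cases hxE : x ∈ E <;> simp [hxS, hxE, hAdef]
  have hpi : IntegrableOn p A Q := integrableOn_of_integrable_cond hA0 integrable_condExp
  have e2 : b * (Q.real (S ∩ E) + Q.real (S ∩ C)) ≤
      ∫ x in A, S.indicator (fun _ => (1 : ℝ)) x * p x ∂Q := by
    have : Q.real (S ∩ E) + Q.real (S ∩ C) = ∫ x in A, S.indicator (fun _ => (1 : ℝ)) x ∂Q := by
      rw [← measureReal_union (hdisj.mono Set.inter_subset_right Set.inter_subset_right)
        (hSm'.inter hC), ← Set.inter_union_distrib_left, ← hAdef, ← integral_indicator_one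
        (hSm'.inter hA), ← integral_indicator hA]
      congr 1 with x
      by_cases hxS : x ∈ S <;> by_cases hxA : x ∈ A <;> simp [hxS, hxA]
    rw [this, ← integral_const_mul]
    refine integral_mono (((integrable_const (1 : ℝ)).indicator hSm').const_mul b)
      (hpi.bdd_mul (c := 1)
        ((stronglyMeasurable_const.indicator hSm').aestronglyMeasurable)
        (Eventually.of_forall fun x => by by_cases hx : x ∈ S <;> simp [hx])) fun x => ?_
    by_cases hx : x ∈ S
    · simp only [Set.indicator_of_mem hx, one_mul, mul_one]
      exact hx
    · simp [hx]
  rw [← hp, e1] at hkey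
  have hC0' : 0 ≤ Q.real (S ∩ C) := measureReal_nonneg
  have hE0' : 0 ≤ Q.real (S ∩ E) := measureReal_nonneg
  have hbval : b * (2 + 4 * K) = 1 + 4 * K := by
    rw [hb]; field_simp; ring
  have h3 : (1 + 4 * K) * (Q.real (S ∩ E) + Q.real (S ∩ C)) ≤ (2 + 4 * K) * Q.real (S ∩ E) := by
    rw [← hbval]
    nlinarith [mul_le_mul_of_nonneg_left (e2.trans_eq hkey) (show 0 ≤ 2 + 4 * K by linarith)]
  have hCz : Q.real (S ∩ C) = 0 := by nlinarith
  have hEz : Q.real (S ∩ E) = 0 := by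
    rw [hCz, mul_zero] at hEC
    exact le_antisymm hEC hE0'
  have hAz : Q (A ∩ S) = 0 := by
    rw [measureReal_eq_zero_iff] at hCz hEz
    rw [Set.inter_comm, hAdef, Set.inter_union_distrib_left]
    exact measure_union_null hEz hCz
  have : cond Q A S = 0 := by rw [cond_apply hA, hAz, mul_zero]
  filter_upwards [measure_eq_zero_iff_ae_notMem.1 this] with x hx
  exact not_le.1 hx

/-! ### Efficiency when every bounded mean-zero function is a score -/

section Efficiency

variable {O : Type*} [MeasurableSpace O] {P : Measure O}

lemma inner_toLp_toLp {f g : O → ℝ} (hf : MemLp f 2 P) (hg : MemLp g 2 P) :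
    inner ℝ (hf.toLp f) (hg.toLp g) = ∫ o, f o * g o ∂P := by
  rw [L2.inner_def]
  refine integral_congr_ae ?_
  filter_upwards [hf.coeFn_toLp, hg.coeFn_toLp] with o h1 h2
  rw [h1, h2]
  simp [mul_comm]

lemma exists_tendsto_bounded_mean_zero [IsProbabilityMeasure P] {φ : O → ℝ} (hφ : MemLp φ 2 P)
    (hmean : ∫ o, φ o ∂P = 0) :
    ∃ s : ℕ → O → ℝ, (∀ n, Measurable (s n)) ∧ (∀ n, ∃ B, ∀ o, |s n o| ≤ B) ∧
      (∀ n, ∫ o, s n o ∂P = 0) ∧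
      Tendsto (fun n => eLpNorm (s n - φ) 2 P) atTop (𝓝 0) := by
  have key : ∀ n : ℕ, ∃ s : O → ℝ, Measurable s ∧ (∃ B, ∀ o, |s o| ≤ B) ∧ ∫ o, s o ∂P = 0 ∧
      eLpNorm (s - φ) 2 P ≤ 2 * ((n : ENNReal) + 1)⁻¹ := by
    intro n
    have hpos : ((n : ENNReal) + 1)⁻¹ ≠ 0 := by simp
    obtain ⟨g, hg, hg2⟩ := hφ.exists_simpleFunc_eLpNorm_sub_lt (by norm_num) hpos
    obtain ⟨B, hB⟩ := g.exists_forall_norm_le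
    have hgi : Integrable g P := hg2.integrable (by norm_num)
    have hφi : Integrable φ P := hφ.integrable (by norm_num)
    refine ⟨fun o => g o - ∫ x, g x ∂P, g.measurable.sub_const _,
      ⟨B + |∫ x, g x ∂P|, fun o => (abs_sub _ _).trans (add_le_add (hB o) le_rfl)⟩, ?_, ?_⟩
    · rw [integral_sub hgi (integrable_const _)]
      simp
    · have hgφ : eLpNorm (⇑g - φ) 2 P ≤ ((n : ENNReal) + 1)⁻¹ := by
        rw [← eLpNorm_neg, neg_sub]; exact hg.le
      have hconst : eLpNorm (fun _ : O => ∫ x, g x ∂P) 2 P ≤ ((n : ENNReal) + 1)⁻¹ := by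
        rw [eLpNorm_const _ (by norm_num) (IsProbabilityMeasure.ne_zero P)]
        simp only [measure_univ, ENNReal.one_rpow, mul_one]
        calc ‖∫ x, g x ∂P‖ₑ = ‖∫ x, (⇑g - φ) x ∂P‖ₑ := by
              simp only [Pi.sub_apply]
              rw [integral_sub hgi hφi, hmean, sub_zero]
          _ ≤ eLpNorm (⇑g - φ) 1 P := by
              rw [eLpNorm_one_eq_lintegral_enorm]
              exact enorm_integral_le_lintegral_enorm _
          _ ≤ eLpNorm (⇑g - φ) 2 P :=
              eLpNorm_le_eLpNorm_of_exponent_le (by norm_num) (hg2.sub hφ).1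
          _ ≤ _ := hgφ
      have heq : (fun o => g o - ∫ x, g x ∂P) - φ = (⇑g - φ) - fun _ => ∫ x, g x ∂P := by
        funext o
        simp only [Pi.sub_apply]
        ring
      rw [heq, two_mul]
      exact (eLpNorm_sub_le (hg2.sub hφ).1 aestronglyMeasurable_const (by norm_num)).trans
        (add_le_add hgφ hconst)
  choose s h1 h2 h3 h4 using key
  refine ⟨s, h1, h2, h3, ?_⟩
  refine tendsto_of_tendsto_of_tendsto_of_le_of_le tendsto_const_nhds ?_ (fun _ => zero_le) h4
  have hlim : Tendsto (fun n : ℕ => ((n : ENNReal) + 1)⁻¹) atTop (𝓝 0) := by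
    have := (tendsto_add_atTop_iff_nat 1).2 ENNReal.tendsto_inv_nat_nhds_zero
    simpa using this
  simpa using ENNReal.Tendsto.const_mul hlim (Or.inr ENNReal.ofNat_ne_top)

/-- If every bounded mean-zero function is a score of the model, then the tangent space is the
space of all mean-zero functions in `L²(P)`, so that any mean-zero gradient is the efficient
influence function, and its second moment is the efficiency bound. The function `s₀` only
ensures that the model has a submodel with nonzero information. -/
theorem isEfficient_of_bounded_scores [IsProbabilityMeasure P]
    {S : Set ((ℝ → Measure O) × (O → ℝ))} {ψ : Measure O → ℝ} {φ : O → ℝ}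
    (hφ : MemLp φ 2 P) (hmean : ∫ o, φ o ∂P = 0)
    (hderiv : ∀ q ∈ S, HasDerivAt (fun ε : ℝ => ψ (q.1 ε)) (∫ o, φ o * q.2 o ∂P) 0)
    (hscore : ∀ q ∈ S, MemLp q.2 2 P)
    (hrich : ∀ s : O → ℝ, Measurable s → (∃ B, ∀ o, |s o| ≤ B) → ∫ o, s o ∂P = 0 →
      ∃ q ∈ S, q.2 = s)
    {s₀ : O → ℝ} (hs₀ : Measurable s₀) (hs₀B : ∃ B, ∀ o, |s₀ o| ≤ B)
    (hs₀m : ∫ o, s₀ o ∂P = 0) (hs₀pos : 0 < ∫ o, s₀ o ^ 2 ∂P) :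
    IsEfficientInfluenceFunction S P ψ φ ∧ IsEfficiencyBound S P ψ (∫ o, φ o ^ 2 ∂P) := by
  obtain ⟨s, hsm, hsB, hs0, hslim⟩ := exists_tendsto_bounded_mean_zero hφ hmean
  have hsL : ∀ n, MemLp (s n) 2 P := fun n => by
    obtain ⟨B, hB⟩ := hsB n
    exact MemLp.of_bound (hsm n).aestronglyMeasurable B (Eventually.of_forall hB)
  have htend : Tendsto (fun n => (hsL n).toLp (s n)) atTop (𝓝 (hφ.toLp φ)) :=
    (Lp.tendsto_Lp_iff_tendsto_eLpNorm'' s hsL φ hφ).2 hslim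
  have hsq : ∀ f : O → ℝ, ∫ o, f o * f o ∂P = ∫ o, f o ^ 2 ∂P := fun f => by
    simp_rw [pow_two]
  refine ⟨⟨hφ, hmean, hderiv, ?_⟩, ?_, ?_⟩
  · refine mem_closure_of_tendsto htend (Eventually.of_forall fun n => ?_)
    obtain ⟨q, hq, hqs⟩ := hrich (s n) (hsm n) (hsB n) (hs0 n)
    exact Submodule.subset_span ⟨q, hq, by rw [hqs]; exact (hsL n).coeFn_toLp⟩
  · rintro b ⟨q, hq, d, hpos, hd, rfl⟩
    rw [hd.unique (hderiv q hq), div_le_iff₀ hpos, ← hsq φ, ← hsq q.2, pow_two,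
      ← inner_toLp_toLp hφ (hscore q hq), ← inner_toLp_toLp hφ hφ,
      ← inner_toLp_toLp (hscore q hq) (hscore q hq)]
    exact real_inner_mul_inner_self_le _ _
  · intro b hb
    have hmem : ∀ f : O → ℝ, Measurable f → (∃ B, ∀ o, |f o| ≤ B) → ∫ o, f o ∂P = 0 →
        0 < ∫ o, f o ^ 2 ∂P → (∫ o, φ o * f o ∂P) ^ 2 / ∫ o, f o ^ 2 ∂P ≤ b := by
      intro f hf hfB hf0 hfpos
      obtain ⟨q, hq, rfl⟩ := hrich f hf hfB hf0
      exact hb ⟨q, hq, _, hfpos, hderiv q hq, rfl⟩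
    rcases (integral_nonneg fun o => sq_nonneg (φ o) : 0 ≤ ∫ o, φ o ^ 2 ∂P).eq_or_lt with h0 | h0
    · rw [← h0]
      exact le_trans (by positivity) (hmem s₀ hs₀ hs₀B hs₀m hs₀pos)
    · -- The Cramér–Rao bounds in the directions `s n → φ` converge to `E[φ²]`.
      set Φ := hφ.toLp φ with hΦ
      have hVΦ : ∫ o, φ o ^ 2 ∂P = inner ℝ Φ Φ := by rw [hΦ, inner_toLp_toLp, hsq]
      have hne : (inner ℝ Φ Φ : ℝ) ≠ 0 := by rw [← hVΦ]; exact h0.ne'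
      have l1 : Tendsto (fun n => (inner ℝ Φ ((hsL n).toLp (s n)) : ℝ)) atTop
          (𝓝 (inner ℝ Φ Φ)) := tendsto_const_nhds.inner htend
      have l2 : Tendsto (fun n => (inner ℝ ((hsL n).toLp (s n)) ((hsL n).toLp (s n)) : ℝ)) atTop
          (𝓝 (inner ℝ Φ Φ)) := htend.inner htend
      have l3 := (l1.pow 2).div l2 hne
      rw [pow_two, mul_div_assoc, div_self hne, mul_one, ← hVΦ] at l3
      refine le_of_tendsto l3 ?_
      filter_upwards [l2.eventually (lt_mem_nhds (hVΦ ▸ h0))] with n hn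
      simp only [Pi.div_apply]
      rw [inner_toLp_toLp, inner_toLp_toLp, hsq]
      rw [inner_toLp_toLp, hsq] at hn
      exact hmem (s n) (hsm n) (hsB n) (hs0 n) hn

end Efficiency

end Semiparametric

/-! ### The panel model -/

namespace Panel

open Semiparametric

variable {𝒯 : ℕ} {𝒳 : Type*}

lemma disjoint_exposed_control (k : CohortTime 𝒯) (G : ControlGroup) :
    Disjoint (exposed k : Set (Obs 𝒯 𝒳)) (control k G) := by
  rw [Set.disjoint_left]
  intro o ho hC
  have ho : cohort o = (k.e : ℕ∞) := ho
  cases G with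
  | never => exact ENat.natCast_ne_top k.e (ho.symm.trans hC)
  | notYet => exact hC.1 ho

lemma abs_deltaD_le (k : CohortTime 𝒯) (o : Obs 𝒯 𝒳) : |deltaD k o| ≤ 1 := by
  unfold deltaD treatment
  split_ifs <;> norm_num

variable [MeasurableSpace 𝒳]

/-- Events that depend on the instrument path only are measurable. -/
lemma measurableSet_of_instrument (S : Set (Period 𝒯 → Bool)) :
    MeasurableSet {o : Obs 𝒯 𝒳 | o.2.2.1 ∈ S} := by
  have hZ : Measurable fun o : Obs 𝒯 𝒳 => o.2.2.1 := by fun_prop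
  exact hZ S.toFinite.measurableSet

lemma measurableSet_exposed (k : CohortTime 𝒯) : MeasurableSet (exposed k : Set (Obs 𝒯 𝒳)) :=
  measurableSet_of_instrument
    {z | (⨅ (t : Period 𝒯) (_ : z t = true), ((t : ℕ) : ℕ∞)) = (k.e : ℕ∞)}

lemma measurableSet_control (k : CohortTime 𝒯) (G : ControlGroup) :
    MeasurableSet (control k G : Set (Obs 𝒯 𝒳)) := by
  cases G with
  | never =>
    exact measurableSet_of_instrument
      {z | (⨅ (t : Period 𝒯) (_ : z t = true), ((t : ℕ) : ℕ∞)) = ⊤}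
  | notYet =>
    exact measurableSet_of_instrument
      {z | (⨅ (t : Period 𝒯) (_ : z t = true), ((t : ℕ) : ℕ∞)) ≠ (k.e : ℕ∞) ∧
        z k.post = false}

lemma measurable_deltaD (k : CohortTime 𝒯) : Measurable (deltaD k : Obs 𝒯 𝒳 → ℝ) := by
  have h : ∀ t : Period 𝒯, Measurable (treatment t : Obs 𝒯 𝒳 → ℝ) := fun t => by
    have hD : Measurable fun o : Obs 𝒯 𝒳 => o.2.1 t := by fun_prop
    exact Measurable.ite (hD (measurableSet_singleton true)) measurable_const measurable_const
  exact (h _).sub (h _)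

lemma comap_covariates_le :
    MeasurableSpace.comap (covariates : Obs 𝒯 𝒳 → 𝒳) inferInstance ≤
      (inferInstance : MeasurableSpace (Obs 𝒯 𝒳)) := by
  have h : Measurable (covariates : Obs 𝒯 𝒳 → 𝒳) := by unfold covariates; fun_prop
  exact h.comap_le

/-- The odds of exposure against control given the covariates, bounded by `(1 - c) / c`. -/
noncomputable def ctrlOdds (k : CohortTime 𝒯) (G : ControlGroup) (c : ℝ)
    (P : Measure (Obs 𝒯 𝒳)) : Obs 𝒯 𝒳 → ℝ :=
  clippedOdds c (propensity k G P)

/-- The signed weight `E_e - C p(X) / (1 - p(X))`, that is, `P(E_e = 1) (w^trt - w^c)`. -/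
noncomputable def ctrlContrast (k : CohortTime 𝒯) (G : ControlGroup) (c : ℝ)
    (P : Measure (Obs 𝒯 𝒳)) : Obs 𝒯 𝒳 → ℝ :=
  IsBalancingWeight.contrast (exposed k) (control k G) (ctrlOdds k G c P)

/-- The residual `V - E_P[V | X, C = 1]` on the exposed and control units, and zero elsewhere. -/
noncomputable def residual (k : CohortTime 𝒯) (G : ControlGroup) (V : Obs 𝒯 𝒳 → ℝ)
    (P : Measure (Obs 𝒯 𝒳)) : Obs 𝒯 𝒳 → ℝ :=
  (exposed k ∪ control k G).indicator fun o => V o - condMean P (control k G) V o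

variable {k : CohortTime 𝒯} {G : ControlGroup} {c : ℝ} {P : Measure (Obs 𝒯 𝒳)}
  {V : Obs 𝒯 𝒳 → ℝ}

/-- Both weights vanish off the exposed and control units, so there the residual may be set to
zero. -/
lemma ctrlContrast_mul_residual (Q : Measure (Obs 𝒯 𝒳)) (o : Obs 𝒯 𝒳) :
    ctrlContrast k G c Q o * residual k G V P o =
      ctrlContrast k G c Q o * (V o - condMean P (control k G) V o) := by
  by_cases hE : o ∈ exposed k <;> by_cases hC : o ∈ control k G <;>
    simp [ctrlContrast, IsBalancingWeight.contrast, residual, hE, hC]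

lemma stronglyMeasurable_condMean (A : Set (Obs 𝒯 𝒳)) :
    StronglyMeasurable[MeasurableSpace.comap (covariates : Obs 𝒯 𝒳 → 𝒳) inferInstance]
      (condMean P A V) :=
  stronglyMeasurable_condExp

namespace InModel

lemma measure_exposed_ne_zero (hP : InModel k G c P) (hc : 0 < c) : P (exposed k) ≠ 0 := by
  intro h0
  have h := hP.exposed_pos
  rw [measureReal_def, h0, ENNReal.toReal_zero] at h
  linarith

lemma lt_one (hP : InModel k G c P) : c < 1 := by
  have := hP.isProbabilityMeasure
  exact hP.exposed_pos.trans_le measureReal_le_one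

lemma isBalancingWeight (hP : InModel k G c P) (hc : 0 < c) :
    IsBalancingWeight (MeasurableSpace.comap (covariates : Obs 𝒯 𝒳 → 𝒳) inferInstance) P
      (exposed k) (control k G) ((1 - c) / c) (ctrlOdds k G c P) := by
  have := hP.isProbabilityMeasure
  exact (isBalancingWeight_clippedOdds comap_covariates_le (measurableSet_exposed k)
    (measurableSet_control k G) (disjoint_exposed_control k G) (hP.measure_exposed_ne_zero hc) hc
    hP.lt_one hP.overlap).1

lemma ctrlOdds_ae_eq (hP : InModel k G c P) (hc : 0 < c) :
    ∀ᵐ o ∂P, o ∈ control k G →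
      ctrlOdds k G c P o = propensity k G P o / (1 - propensity k G P o) := by
  have := hP.isProbabilityMeasure
  exact (isBalancingWeight_clippedOdds comap_covariates_le (measurableSet_exposed k)
    (measurableSet_control k G) (disjoint_exposed_control k G) (hP.measure_exposed_ne_zero hc) hc
    hP.lt_one hP.overlap).2

lemma measure_control_ne_zero (hP : InModel k G c P) (hc : 0 < c) : P (control k G) ≠ 0 := by
  intro h0
  have h := (hP.isBalancingWeight hc).setLIntegral_eq Set.univ MeasurableSet.univ
  rw [Set.univ_inter, Set.univ_inter, Measure.restrict_eq_zero.2 h0, lintegral_zero_measure] at h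
  exact hP.measure_exposed_ne_zero hc h.symm

lemma abs_ctrlContrast_le (hP : InModel k G c P) (hc : 0 < c) (o : Obs 𝒯 𝒳) :
    |ctrlContrast k G c P o| ≤ 1 + (1 - c) / c :=
  (hP.isBalancingWeight hc).abs_contrast_le o

lemma measurable_ctrlContrast (hP : InModel k G c P) (hc : 0 < c) :
    Measurable (ctrlContrast k G c P) :=
  (hP.isBalancingWeight hc).measurable_contrast comap_covariates_le (measurableSet_exposed k)
    (measurableSet_control k G)

lemma memLp_deltaD (hP : InModel k G c P) : MemLp (deltaD k) 2 P := by
  have := hP.isProbabilityMeasure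
  exact MemLp.of_bound (measurable_deltaD k).aestronglyMeasurable 1
    (Eventually.of_forall (abs_deltaD_le k))

/-- The conditional mean in the control group is square integrable among the controls by Jensen's
inequality, and hence, by overlap, among the exposed. -/
lemma memLp_indicator_condMean (hP : InModel k G c P) (hc : 0 < c) (hV : MemLp V 2 P) :
    MemLp ((exposed k ∪ control k G).indicator (condMean P (control k G) V)) 2 P := by
  have := hP.isProbabilityMeasure
  have hC0 := hP.measure_control_ne_zero hc
  have hVC : MemLp V 2 (cond P (control k G)) :=
    (hV.restrict _).smul_measure (ENNReal.inv_ne_top.2 hC0)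
  have hC : MemLp (condMean P (control k G) V) 2 (P.restrict (control k G)) := by
    rw [restrict_eq_smul_cond hC0]
    exact (hVC.condExp (by norm_num)).smul_measure (measure_ne_top P _)
  have hE := (hP.isBalancingWeight hc).memLp_two comap_covariates_le
    (stronglyMeasurable_condMean _) hC
  rw [Set.indicator_union_of_disjoint (disjoint_exposed_control k G)]
  exact ((memLp_indicator_iff_restrict (measurableSet_exposed k)).2 hE).add
    ((memLp_indicator_iff_restrict (measurableSet_control k G)).2 hC)

lemma memLp_residual (hP : InModel k G c P) (hc : 0 < c) (hV : MemLp V 2 P) :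
    MemLp (residual k G V P) 2 P := by
  have h := (hV.indicator ((measurableSet_exposed k).union (measurableSet_control k G))).sub
    (hP.memLp_indicator_condMean hc hV)
  rw [← Set.indicator_sub'] at h
  exact h

lemma memLp_ctrlContrast_mul_residual (hP : InModel k G c P) (hc : 0 < c) (hV : MemLp V 2 P) :
    MemLp (fun o => ctrlContrast k G c P o * residual k G V P o) 2 P := by
  refine (hP.memLp_residual hc hV).of_le_mul (c := 1 + (1 - c) / c)
    ((hP.measurable_ctrlContrast hc).aestronglyMeasurable.mul (hP.memLp_residual hc hV).1)
    (Eventually.of_forall fun o => ?_)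
  rw [norm_mul]
  exact mul_le_mul_of_nonneg_right (hP.abs_ctrlContrast_le hc o) (norm_nonneg _)

/-- Under any distribution `Q` of the model the functional is a weighted mean of the residuals
taken with respect to a fixed `P`; only the weight depends on `Q`. -/
lemma attFunctional_eq {Q : Measure (Obs 𝒯 𝒳)} (hQ : InModel k G c Q) (hc : 0 < c)
    (hV : Integrable V Q)
    (hg : Integrable ((exposed k ∪ control k G).indicator (condMean P (control k G) V)) Q) :
    attFunctional k G V Q = (Q.real (exposed k))⁻¹ *
      ∫ o, ctrlContrast k G c Q o * residual k G V P o ∂Q := by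
  have := hQ.isProbabilityMeasure
  have hgC : IntegrableOn (condMean P (control k G) V) (control k G) Q :=
    hg.integrableOn.congr_fun (fun o ho => Set.indicator_of_mem (Set.mem_union_right _ ho) _)
      (measurableSet_control k G)
  simp_rw [ctrlContrast_mul_residual]
  exact (hQ.isBalancingWeight hc).integral_condExp_sub_condExp comap_covariates_le
    (measurableSet_exposed k) (measurableSet_control k G) (hQ.measure_exposed_ne_zero hc)
    (hQ.measure_control_ne_zero hc) hV (stronglyMeasurable_condMean _) hgC

lemma attFunctional_self_eq (hP : InModel k G c P) (hc : 0 < c) (hV : MemLp V 2 P) :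
    attFunctional k G V P = (P.real (exposed k))⁻¹ *
      ∫ o, ctrlContrast k G c P o * residual k G V P o ∂P := by
  have := hP.isProbabilityMeasure
  exact hP.attFunctional_eq hc (hV.integrable (by norm_num))
    ((hP.memLp_indicator_condMean hc hV).integrable (by norm_num))

/-- The residuals have conditional mean zero among the controls, so that a bounded function of
the covariates as control weight, for whichever `Q` it was derived from, does not change their
weighted mean under `P`. -/
lemma integral_ctrlContrast_mul_residual {Q : Measure (Obs 𝒯 𝒳)} {c' : ℝ}
    (hP : InModel k G c P) (hc : 0 < c) (hQ : InModel k G c' Q) (hc' : 0 < c')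
    (hV : MemLp V 2 P) :
    ∫ o, ctrlContrast k G c' Q o * residual k G V P o ∂P =
      ∫ o in exposed k, residual k G V P o ∂P := by
  have := hP.isProbabilityMeasure
  have hw := hQ.isBalancingWeight hc'
  have hwm := hw.stronglyMeasurable.mono comap_covariates_le
  have hr : Integrable (residual k G V P) P := (hP.memLp_residual hc hV).integrable (by norm_num)
  have hVi : Integrable V P := hV.integrable (by norm_num)
  have hC0 := hP.measure_control_ne_zero hc
  have hgC : IntegrableOn (condMean P (control k G) V) (control k G) P :=
    integrableOn_of_integrable_cond hC0 integrable_condExp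
  have hmul : ∀ f : Obs 𝒯 𝒳 → ℝ, IntegrableOn f (control k G) P →
      IntegrableOn (fun o => ctrlOdds k G c' Q o * f o) (control k G) P := fun f hf =>
    hf.bdd_mul hwm.aestronglyMeasurable (Eventually.of_forall hw.abs_le)
  have hz : ∫ o in control k G, ctrlOdds k G c' Q o * residual k G V P o ∂P = 0 := by
    have e : ∫ o in control k G, ctrlOdds k G c' Q o * residual k G V P o ∂P =
        ∫ o in control k G, (ctrlOdds k G c' Q o * V o -
          ctrlOdds k G c' Q o * condMean P (control k G) V o) ∂P :=
      setIntegral_congr_fun (measurableSet_control k G) fun o ho => by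
        simp only [residual]
        rw [Set.indicator_of_mem (Set.mem_union_right _ ho), mul_sub]
    rw [e, integral_sub (hmul _ hVi.integrableOn) (hmul _ hgC), sub_eq_zero]
    exact (setIntegral_mul_condExp_cond comap_covariates_le hC0 hw.stronglyMeasurable hw.abs_le
      hVi.integrableOn).symm
  rw [ctrlContrast, IsBalancingWeight.integral_contrast_mul hwm.measurable hw.abs_le
    (measurableSet_exposed k) (measurableSet_control k G) hr.integrableOn hr.integrableOn, hz,
    sub_zero]

/-- The efficient influence function written with the bounded control weight. -/
lemma eif_ae_eq (hP : InModel k G c P) (hc : 0 < c) :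
    eif k G P =ᵐ[P] fun o => (P.real (exposed k) * tauDen k G P)⁻¹ *
      (ctrlContrast k G c P o * residual k G (deltaY k) P o -
        tau k G P * (ctrlContrast k G c P o * residual k G (deltaD k) P o)) := by
  have := hP.isProbabilityMeasure
  have hae := hP.ctrlOdds_ae_eq hc
  have hodds : ∀ᵐ o ∂P, oddsCtrl k G P o = (control k G).indicator (ctrlOdds k G c P) o := by
    filter_upwards [hae] with o ho
    by_cases h : o ∈ control k G
    · simp only [oddsCtrl, Set.indicator_of_mem h, ho h]
    · simp only [oddsCtrl, Set.indicator_of_notMem h]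
  -- The normalizing constant of the control weight is `P(E_e = 1)`.
  have hnorm : ∫ o, oddsCtrl k G P o ∂P = P.real (exposed k) := by
    rw [integral_congr_ae hodds, integral_indicator (measurableSet_control k G)]
    have h := (hP.isBalancingWeight hc).setIntegral_eq comap_covariates_le
      (stronglyMeasurable_const (b := (1 : ℝ)))
    simp only [mul_one, integral_const, smul_eq_mul, measureReal_restrict_apply_univ] at h
    exact h.symm
  filter_upwards [hodds] with o ho
  rw [ctrlContrast_mul_residual, ctrlContrast_mul_residual, eif, weightTrt, weightCtrl, hnorm, ho,
    ← sub_div, ctrlContrast, IsBalancingWeight.contrast, mul_inv]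
  simp only [div_eq_mul_inv, one_mul]
  ring

end InModel

/-! ### Differentiability of the estimand -/

/-- Along a submodel the derivative of the weighted mean of the residuals is the covariance of
the weighted residual with the score: the dependence of the weight on the distribution does not
contribute. -/
theorem hasDerivAt_integral_ctrlContrast {Q : ℝ → Measure (Obs 𝒯 𝒳)} {s : Obs 𝒯 𝒳 → ℝ}
    (hpath : IsDifferentiablePath P Q s) (hc : 0 < c)
    (hmodel : ∀ᶠ ε in 𝓝 (0 : ℝ), InModel k G c (Q ε)) (hV : MemLp V 2 P) :
    HasDerivAt (fun ε => ∫ o, ctrlContrast k G c (Q ε) o * residual k G V P o ∂(Q ε))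
      (∫ o, ctrlContrast k G c P o * residual k G V P o * s o ∂P) 0 := by
  have hP : InModel k G c P := hpath.zero ▸ hmodel.self_of_nhds
  have := hP.isProbabilityMeasure
  have hmain := hpath.hasDerivAt_integral_mul (u := fun ε => ctrlContrast k G c (Q ε))
    (f := residual k G V P) (K := 1 + (1 - c) / c)
    (a := ∫ o in exposed k, residual k G V P o ∂P) (hP.memLp_residual hc hV)
    (hmodel.mono fun ε hε => (hε.measurable_ctrlContrast hc).aestronglyMeasurable)
    (hmodel.mono fun ε hε => hε.abs_ctrlContrast_le hc)
    (hmodel.mono fun ε hε => hP.integral_ctrlContrast_mul_residual hc hε hc hV)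
  simp only [hpath.zero] at hmain
  refine hmain ?_
  have hK : 0 ≤ (1 - c) / c := div_nonneg (by linarith [hP.lt_one]) hc.le
  have hlim := hpath.tendsto_integral_abs_sub_one.const_mul ((1 - c) / c + 1)
  rw [mul_zero] at hlim
  refine squeeze_zero' (Eventually.of_forall fun ε => integral_nonneg fun o => abs_nonneg _) ?_
    hlim
  filter_upwards [hmodel.filter_mono nhdsWithin_le_nhds,
    hpath.absolutelyContinuous.filter_mono nhdsWithin_le_nhds] with ε hε hac
  have := hε.isProbabilityMeasure
  refine le_trans (le_of_eq ?_) (IsBalancingWeight.setIntegral_abs_sub_le comap_covariates_le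
    (measurableSet_exposed k) (measurableSet_control k G) (hP.isBalancingWeight hc)
    (hε.isBalancingWeight hc) hac hK)
  rw [← integral_indicator (measurableSet_control k G)]
  congr 1 with o
  by_cases h : o ∈ control k G
  · simp only [ctrlContrast, IsBalancingWeight.contrast, Set.indicator_of_mem h]
    rw [sub_sub_sub_cancel_left, abs_sub_comm]
  · simp [ctrlContrast, IsBalancingWeight.contrast, h]

theorem hasDerivAt_tau {q : (ℝ → Measure (Obs 𝒯 𝒳)) × (Obs 𝒯 𝒳 → ℝ)}
    (hq : q ∈ submodels k G P) (hden : tauDen k G P ≠ 0) :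
    HasDerivAt (fun ε : ℝ => tau k G (q.1 ε)) (∫ o, eif k G P o * q.2 o ∂P) 0 := by
  obtain ⟨hpath, c, hc, hmodel⟩ := hq
  have hP : InModel k G c P := hpath.zero ▸ hmodel.self_of_nhds
  have := hP.isProbabilityMeasure
  have hY := hP.memLp_deltaY
  have hD := hP.memLp_deltaD
  have hρ : P.real (exposed k) ≠ 0 := (hc.trans hP.exposed_pos).ne'
  have hNY := hP.attFunctional_self_eq hc hY
  have hND := hP.attFunctional_self_eq hc hD
  have dY := hasDerivAt_integral_ctrlContrast hpath hc hmodel hY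
  have dD := hasDerivAt_integral_ctrlContrast hpath hc hmodel hD
  -- The factor `P(E_e = 1)` cancels in the ratio.
  have heq : (fun ε => tau k G (q.1 ε)) =ᶠ[𝓝 0] fun ε =>
      (∫ o, ctrlContrast k G c (q.1 ε) o * residual k G (deltaY k) P o ∂(q.1 ε)) /
        ∫ o, ctrlContrast k G c (q.1 ε) o * residual k G (deltaD k) P o ∂(q.1 ε) := by
    filter_upwards [hmodel, hpath.memLp_rnDeriv, hpath.absolutelyContinuous] with ε hε hL hac
    have := hε.isProbabilityMeasure
    have hρε : ((q.1 ε).real (exposed k))⁻¹ ≠ 0 := inv_ne_zero (hc.trans hε.exposed_pos).ne'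
    have hint : ∀ {f : Obs 𝒯 𝒳 → ℝ}, MemLp f 2 P → Integrable f (q.1 ε) := fun hf =>
      integrable_of_memLp_rnDeriv hac hL hf
    rw [tau, tauNum, tauDen, hε.attFunctional_eq (P := P) hc (hint hY)
      (hint (hP.memLp_indicator_condMean hc hY)), hε.attFunctional_eq (P := P) hc (hint hD)
      (hint (hP.memLp_indicator_condMean hc hD)), mul_div_mul_left _ _ hρε]
  have hval : ∫ o, eif k G P o * q.2 o ∂P = (P.real (exposed k) * tauDen k G P)⁻¹ *
      (∫ o, ctrlContrast k G c P o * residual k G (deltaY k) P o * q.2 o ∂P -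
        tau k G P * ∫ o, ctrlContrast k G c P o * residual k G (deltaD k) P o * q.2 o ∂P) := by
    have iY : Integrable
        (fun o => ctrlContrast k G c P o * residual k G (deltaY k) P o * q.2 o) P :=
      (hP.memLp_ctrlContrast_mul_residual hc hY).integrable_mul hpath.memLp_score
    have iD : Integrable
        (fun o => ctrlContrast k G c P o * residual k G (deltaD k) P o * q.2 o) P :=
      (hP.memLp_ctrlContrast_mul_residual hc hD).integrable_mul hpath.memLp_score
    rw [← integral_const_mul (tau k G P), ← integral_sub iY (iD.const_mul _),
      ← integral_const_mul]
    refine integral_congr_ae ?_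
    filter_upwards [hP.eif_ae_eq hc] with o ho
    rw [ho]
    ring
  set NY := ∫ o, ctrlContrast k G c P o * residual k G (deltaY k) P o ∂P with hNYdef
  set ND := ∫ o, ctrlContrast k G c P o * residual k G (deltaD k) P o ∂P with hNDdef
  have hden' : ND ≠ 0 := fun h => hden (by rw [tauDen, hND, h, mul_zero])
  refine HasDerivAt.congr_of_eventuallyEq ?_ heq
  have hdiv := dY.fun_div dD (by rw [hpath.zero]; exact hden')
  rw [hpath.zero, ← hNYdef, ← hNDdef] at hdiv
  refine hdiv.congr_deriv ?_
  rw [hval, tau, tauNum, tauDen, hNY, hND]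
  field_simp

/-! ### The bounded perturbations lie in the model -/

theorem tilt_mem_submodels (hP : InModel k G c P) (hc : 0 < c) {s : Obs 𝒯 𝒳 → ℝ} {B : ℝ}
    (hs : Measurable s) (hB : ∀ o, |s o| ≤ B) (hmean : ∫ o, s o ∂P = 0) :
    (tilt P s, s) ∈ submodels k G P := by
  have := hP.isProbabilityMeasure
  have hpath := isDifferentiablePath_tilt hs hB hmean
  have hK : 0 ≤ (1 - c) / c := div_nonneg (by linarith [hP.lt_one]) hc.le
  refine ⟨hpath, min (c / 2) (1 / (2 + 4 * ((1 - c) / c))), lt_min (by linarith)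
    (by positivity), ?_⟩
  filter_upwards [eventually_abs_mul_le hB, hpath.isProbabilityMeasure] with ε hε hprob
  have hexp : c / 2 < (tilt P s ε).real (exposed k) := by
    have hle : P (exposed k) ≤ 2 * tilt P s ε (exposed k) := by
      simpa using le_smul_tilt (P := P) hs hε (exposed k)
    have h := ENNReal.toReal_mono (by finiteness) hle
    rw [ENNReal.toReal_mul, ENNReal.toReal_ofNat] at h
    have h' := hP.exposed_pos
    rw [measureReal_def] at h' ⊢
    linarith
  refine ⟨hprob, (tilt_absolutelyContinuous P s ε).ae_le hP.staggered,
    hP.memLp_deltaY.of_measure_le_smul ENNReal.ofNat_ne_top (tilt_le_smul hε),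
    (min_le_left _ _).trans_lt hexp, ?_⟩
  have h0 : tilt P s ε (exposed k) ≠ 0 := fun h => by
    rw [measureReal_def, h, ENNReal.toReal_zero] at hexp
    linarith
  filter_upwards [overlap_of_le_smul (hP.isBalancingWeight hc) comap_covariates_le
    (measurableSet_exposed k) (measurableSet_control k G) (disjoint_exposed_control k G) hK
    (tilt_le_smul hε) (le_smul_tilt hs hε) h0] with o ho
  exact lt_of_lt_of_le ho (sub_le_sub_left (min_le_right _ _) 1)

end Panel

/-! ### The efficient influence function of the estimand -/

theorem mainTheorem3 {𝒯 : ℕ} {𝒳 : Type*} [MeasurableSpace 𝒳]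
    (k : Panel.CohortTime 𝒯) (G : Panel.ControlGroup) (P : Measure (Panel.Obs 𝒯 𝒳))
    (c : ℝ) (hc : 0 < c) (hP : Panel.InModel k G c P) (hden : Panel.tauDen k G P ≠ 0) :
    Semiparametric.IsEfficientInfluenceFunction (Panel.submodels k G P) P
        (Panel.tau k G) (Panel.eif k G P) ∧
      Semiparametric.IsEfficiencyBound (Panel.submodels k G P) P (Panel.tau k G)
        (∫ o, Panel.eif k G P o ^ 2 ∂P) := by
  have := hP.isProbabilityMeasure
  have hρ : 0 < P.real (Panel.exposed k) := hc.trans hP.exposed_pos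
  have hE := Panel.measurableSet_exposed (𝒳 := 𝒳) k
  have hY := hP.memLp_ctrlContrast_mul_residual hc hP.memLp_deltaY
  have hD := hP.memLp_ctrlContrast_mul_residual hc hP.memLp_deltaD
  have hφ : MemLp (Panel.eif k G P) 2 P :=
    ((hY.sub (hD.const_mul (Panel.tau k G P))).const_mul _).ae_eq (hP.eif_ae_eq hc).symm
  have hmean : ∫ o, Panel.eif k G P o ∂P = 0 := by
    have hNY : Panel.tauNum k G P = _ := hP.attFunctional_self_eq hc hP.memLp_deltaY
    have hND : Panel.tauDen k G P = _ := hP.attFunctional_self_eq hc hP.memLp_deltaD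
    have iY := hY.integrable (by norm_num)
    have iD := hD.integrable (by norm_num)
    rw [integral_congr_ae (hP.eif_ae_eq hc), integral_const_mul,
      integral_sub iY (iD.const_mul _), integral_const_mul]
    rw [eq_inv_mul_iff_mul_eq₀ hρ.ne'] at hNY hND
    rw [← hNY, ← hND, Panel.tau]
    field_simp
    ring
  -- A direction of nonzero variance: the centred indicator of exposure.
  have hC : P.real (Panel.control k G) ≠ 0 :=
    (measureReal_ne_zero_iff (measure_ne_top P _)).2 (hP.measure_control_ne_zero hc)
  set s₀ : Panel.Obs 𝒯 𝒳 → ℝ := fun o =>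
    (Panel.exposed k).indicator (fun _ => 1) o - P.real (Panel.exposed k) with hs₀
  have hs₀m : Measurable s₀ := (measurable_const.indicator hE).sub_const _
  have hs₀B : ∀ o, |s₀ o| ≤ 1 := fun o => by
    have h1 : P.real (Panel.exposed k) ≤ 1 := measureReal_le_one
    rw [abs_le]
    by_cases ho : o ∈ Panel.exposed k <;> simp only [hs₀, ho, Set.indicator_of_mem,
      Set.indicator_of_notMem, not_false_eq_true] <;> constructor <;> linarith
  have hs₀z : ∫ o, s₀ o ∂P = 0 := by
    rw [hs₀, integral_sub ((integrable_const (1 : ℝ)).indicator hE) (integrable_const _),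
      integral_indicator hE]
    simp
  have hs₀pos : 0 < ∫ o, s₀ o ^ 2 ∂P := by
    have hi : Integrable (fun o => s₀ o ^ 2) P :=
      (MemLp.of_bound hs₀m.aestronglyMeasurable 1 (Eventually.of_forall hs₀B)).integrable_sq
    refine lt_of_lt_of_le ?_ (setIntegral_le_integral (s := Panel.control k G) hi
      (Eventually.of_forall fun o => sq_nonneg (s₀ o)))
    have he : ∫ o in Panel.control k G, s₀ o ^ 2 ∂P =
        ∫ o in Panel.control k G, P.real (Panel.exposed k) ^ 2 ∂P :=
      setIntegral_congr_fun (Panel.measurableSet_control k G) fun o ho => by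
        have hn : o ∉ Panel.exposed k := fun h =>
          Set.disjoint_left.1 (Panel.disjoint_exposed_control k G) h ho
        simp [hs₀, hn]
    rw [he, setIntegral_const, smul_eq_mul]
    positivity
  exact Semiparametric.isEfficient_of_bounded_scores hφ hmean
    (fun q hq => Panel.hasDerivAt_tau hq hden) (fun q hq => hq.1.memLp_score)
    (fun s hs ⟨B, hB⟩ hs0 => ⟨_, Panel.tilt_mem_submodels hP hc hs hB hs0, rfl⟩)
    hs₀m ⟨1, hs₀B⟩ hs₀z hs₀pos
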